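/- Let $p,q\ge 1$ be integers, $n=p+q$, and let $t_*\in(0,\frac{\pi}{2})$ be defined by $\tan t_*=\sqrt{q/p}$. Let $$C_{t_*}=\{(x,y)\in\mathbb R^{p+1}\times\mathbb R^{q+1} : \|x\|=\cos t_*,\ \|y\|=\sin t_*\}$$ be the minimal generalized Clifford hypersurface of the unit sphere $S^{n+1}\subset\mathbb R^{n+2}=\mathbb R^{p+1}\times\mathbb R^{q+1}$, with the induced metric, with unit normal field $N(x,y)=\big(\sin t_*\,\tfrac{x}{\|x\|},\,-\cos t_*\,\tfrac{y}{\|y\|}\big)$ in $S^{n+1}$ and second fundamental form $B$. A Jacobi field on $C_{t_*}$ is a $C^2$ function $u:C_{t_*}\to\mathbb R$ in the kernel of the linearized mean curvature operator, that is, $$\Delta_{C_{t_*}}u+\big(\|B\|^2+n\big)u=0 \quad\text{on } C_{t_*}.$$ Let $G$ be a finite subgroup of $O(p+1)\times O(q+1)$, acting diagonally on $\mathbb R^{p+1}\times\mathbb R^{q+1}$, which contains the element $$(x,y)\mapsto\big((x_1,-x_2,\dots,-x_{p+1}),(y_1,-y_2,\dots,-y_{q+1})\big).$$ Assume that there are no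 real numbers $a^{kl}$ ($1\le k\le p+1$, $1\le l\le q+1$), not all equal to $0$, such that the function $(x,y)\in\mathbb R^{p+1}\times\mathbb R^{q+1}\mapsto\sum_{k,l}a^{kl}x_ky_l$ is $G$-invariant. Then every $G$-invariant Jacobi field on $C_{t_*}$ vanishes identically. -/

import Mathlib

open scoped InnerProductSpace

noncomputable section

namespace Clifford

section Submanifold

/-! Tangential calculus on a subset `S` of a Euclidean space `E` that is a smooth submanifold.
A function or a vector field on `S` is a map defined on `E` of which only the values on `S` matter:
all derivatives below are derivatives *within* `S`, and they are only used on tangent vectors,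
on which they do not depend on the choice made by `fderivWithin`. -/

variable {E : Type*} [NormedAddCommGroup E] [InnerProductSpace ℝ E] [FiniteDimensional ℝ E]

/-- The tangent space `T_z S`. -/
def tangentPlane (S : Set E) (z : E) : Submodule ℝ E :=
  Submodule.span ℝ (tangentConeAt ℝ S z)

/-- The covariant derivative `v ↦ (D_v X)ᵀ` on `T_z S` of a vector field `X` along `S`:
the tangential part of the ambient derivative. -/
def covDeriv (S : Set E) (X : E → E) (z : E) : tangentPlane S z →ₗ[ℝ] tangentPlane S z :=
  ((tangentPlane S z).orthogonalProjectionOnto ∘L fderivWithin ℝ X S z ∘L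
    (tangentPlane S z).subtypeL).toLinearMap

/-- The gradient of `u` with respect to the induced metric of `S`. -/
def gradOn (S : Set E) (u : E → ℝ) (z : E) : E :=
  (tangentPlane S z).starProjection (gradientWithin u S z)

/-- The divergence of a tangent vector field with respect to the induced metric of `S`. -/
def divOn (S : Set E) (X : E → E) (z : E) : ℝ :=
  LinearMap.trace ℝ (tangentPlane S z) (covDeriv S X z)

/-- The Laplace operator `Δ_S = div grad` of the induced metric of `S`. -/
def laplaceOn (S : Set E) (u : E → ℝ) (z : E) : ℝ :=
  divOn S (gradOn S u) z

/-- The shape operator `v ↦ -(D_v N)ᵀ` for a unit normal field `N`; the second fundamental form is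
`B(v, w) = ⟪shape v, w⟫`. -/
def shape (S : Set E) (N : E → E) (z : E) : tangentPlane S z →ₗ[ℝ] tangentPlane S z :=
  -covDeriv S N z

/-- The squared norm `‖B‖²` of the second fundamental form. -/
def sqNormSecondForm (S : Set E) (N : E → E) (z : E) : ℝ :=
  LinearMap.trace ℝ (tangentPlane S z) ((shape S N z).adjoint ∘ₗ shape S N z)

/-- The linearized mean curvature operator `Δ_S + ‖B‖² + Ric(N, N)` of a hypersurface `S` of the
unit sphere `S^{n+1}` of `E = ℝ^{n+2}` with unit normal field `N` (tangent to the sphere);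
here `Ric(N, N) = n = dim E - 2`. -/
def jacobiOperator (S : Set E) (N : E → E) (u : E → ℝ) (z : E) : ℝ :=
  laplaceOn S u z + (sqNormSecondForm S N z + ((Module.finrank ℝ E : ℝ) - 2)) * u z

/-- `u` is a Jacobi field on `S`: a `C²` function on `S` in the kernel of the linearized mean
curvature operator. -/
structure IsJacobiField (S : Set E) (N : E → E) (u : E → ℝ) : Prop where
  contDiffOn : ContDiffOn ℝ 2 u S
  jacobi_eq : ∀ z ∈ S, jacobiOperator S N u z = 0

end Submanifold

/-- `ℝ^{p+1} × ℝ^{q+1}` with the Euclidean norm. -/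
abbrev Ambient (p q : ℕ) : Type :=
  WithLp 2 (EuclideanSpace ℝ (Fin (p + 1)) × EuclideanSpace ℝ (Fin (q + 1)))

/-- The orthogonal group `O(N+1)`. -/
abbrev Orth (N : ℕ) : Type :=
  EuclideanSpace ℝ (Fin (N + 1)) ≃ₗᵢ[ℝ] EuclideanSpace ℝ (Fin (N + 1))

/-- The generalized Clifford hypersurface `C_t = S^p(cos t) × S^q(sin t)`. -/
def hypersurface (p q : ℕ) (t : ℝ) : Set (Ambient p q) :=
  {z | ‖z.fst‖ = Real.cos t ∧ ‖z.snd‖ = Real.sin t}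

/-- The unit normal field `(sin t · x/‖x‖, -cos t · y/‖y‖)` of `C_t` in the unit sphere. -/
def normal (p q : ℕ) (t : ℝ) (z : Ambient p q) : Ambient p q :=
  WithLp.toLp 2 ((Real.sin t / ‖z.fst‖) • z.fst, -(Real.cos t / ‖z.snd‖) • z.snd)

/-- The angle `t_* ∈ (0, π/2)` with `tan t_* = √(q/p)`. -/
def tStar (p q : ℕ) : ℝ :=
  Real.arctan (Real.sqrt ((q : ℝ) / (p : ℝ)))

/-- The diagonal action of `O(p+1) × O(q+1)` on `ℝ^{p+1} × ℝ^{q+1}`. -/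
def act {p q : ℕ} (σ : Orth p × Orth q) (z : Ambient p q) : Ambient p q :=
  WithLp.toLp 2 (σ.1 z.fst, σ.2 z.snd)

/-- The symmetry `(x₁, x₂, …, x_{N+1}) ↦ (x₁, -x₂, …, -x_{N+1})`. -/
def axisReflection (N : ℕ) : Orth N :=
  LinearIsometryEquiv.piLpCongrRight 2 fun i : Fin (N + 1) =>
    if i = 0 then LinearIsometryEquiv.refl ℝ ℝ else LinearIsometryEquiv.neg ℝ

/-- `f` is `G`-invariant on the (`G`-stable) set `S`. -/
def IsInvariantOn {p q : ℕ} (G : Subgroup (Orth p × Orth q)) (S : Set (Ambient p q))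
    (f : Ambient p q → ℝ) : Prop :=
  ∀ σ ∈ G, ∀ z ∈ S, f (act σ z) = f z

/-- The function `(x, y) ↦ ∑ a^{kl} x_k y_l`. -/
def bilinearFun {p q : ℕ} (a : Fin (p + 1) → Fin (q + 1) → ℝ) (z : Ambient p q) : ℝ :=
  ∑ k, ∑ l, a k l * z.fst k * z.snd l

end Clifford

end

namespace Clifford

noncomputable section

open MeasureTheory Set

section SkewPair

/-- The sum over all pairs of indices of products of two minors (Lagrange's identity). -/
theorem sum_minor_mul_minor {ι : Type*} [Fintype ι] (x v w : ι → ℝ) :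
    ∑ i, ∑ j, (x i * v j - x j * v i) * (x i * w j - x j * w i) =
      2 * ((∑ i, x i * x i) * (∑ i, v i * w i) - (∑ i, x i * v i) * (∑ i, x i * w i)) := by
  have h : ∀ i j, (x i * v j - x j * v i) * (x i * w j - x j * w i) =
      (x i * x i) * (v j * w j) - (x i * w i) * (x j * v j) - (x i * v i) * (x j * w j)
        + (v i * w i) * (x j * x j) := fun i j => by ring
  simp only [h, Finset.sum_add_distrib, Finset.sum_sub_distrib, ← Finset.sum_mul_sum]
  ring

variable {V : Type*} [NormedAddCommGroup V] [InnerProductSpace ℝ V]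

/-- The skew-adjoint map `v ↦ ⟪a, v⟫ b - ⟪b, v⟫ a`. -/
def skewPair (a b : V) : V →L[ℝ] V :=
  (innerSL ℝ a).smulRight b - (innerSL ℝ b).smulRight a

theorem skewPair_apply (a b v : V) : skewPair a b v = ⟪a, v⟫_ℝ • b - ⟪b, v⟫_ℝ • a := by
  simp [skewPair]

theorem inner_skewPair_left (a b v w : V) :
    ⟪skewPair a b v, w⟫_ℝ = ⟪a, v⟫_ℝ * ⟪b, w⟫_ℝ - ⟪b, v⟫_ℝ * ⟪a, w⟫_ℝ := by
  simp [skewPair_apply, inner_sub_left, inner_smul_left]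

theorem inner_skewPair_right (a b v w : V) :
    ⟪w, skewPair a b v⟫_ℝ = -⟪skewPair a b w, v⟫_ℝ := by
  rw [real_inner_comm, inner_skewPair_left, inner_skewPair_left]; ring

theorem inner_skewPair_self (a b v : V) : ⟪v, skewPair a b v⟫_ℝ = 0 := by
  rw [real_inner_comm, inner_skewPair_left]; ring

variable {ι : Type*} [Fintype ι] (b : OrthonormalBasis ι ℝ V)

theorem sum_inner_skewPair_mul (x v w : V) :
    ∑ k : ι × ι, ⟪skewPair (b k.1) (b k.2) x, v⟫_ℝ * ⟪skewPair (b k.1) (b k.2) x, w⟫_ℝ =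
      2 * (⟪x, x⟫_ℝ * ⟪v, w⟫_ℝ - ⟪x, v⟫_ℝ * ⟪x, w⟫_ℝ) := by
  have h : ∀ v w : V, ∑ i, ⟪b i, v⟫_ℝ * ⟪b i, w⟫_ℝ = ⟪v, w⟫_ℝ := fun v w => by
    rw [← b.sum_inner_mul_inner v w]
    simp only [real_inner_comm]
  rw [Fintype.sum_prod_type]
  simp only [inner_skewPair_left]
  rw [sum_minor_mul_minor (fun i => ⟪b i, x⟫_ℝ) (fun i => ⟪b i, v⟫_ℝ) (fun i => ⟪b i, w⟫_ℝ)]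
  simp only [h]

theorem sum_inner_skewPair_skewPair (x w : V) :
    ∑ k : ι × ι, ⟪skewPair (b k.1) (b k.2) x, skewPair (b k.1) (b k.2) w⟫_ℝ =
      2 * ((Fintype.card ι : ℝ) - 1) * ⟪x, w⟫_ℝ := by
  classical
  have h : ∀ v w : V, ∑ i, ⟪b i, v⟫_ℝ * ⟪b i, w⟫_ℝ = ⟪v, w⟫_ℝ := fun v w => by
    rw [← b.sum_inner_mul_inner v w]
    simp only [real_inner_comm]
  have e : ∀ i j, ⟪skewPair (b i) (b j) x, skewPair (b i) (b j) w⟫_ℝ =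
      ⟪b i, x⟫_ℝ * ⟪b i, w⟫_ℝ + ⟪b j, x⟫_ℝ * ⟪b j, w⟫_ℝ
        - if i = j then 2 * (⟪b i, x⟫_ℝ * ⟪b i, w⟫_ℝ) else 0 := fun i j => by
    rw [inner_skewPair_left, skewPair_apply]
    simp only [inner_sub_right, inner_smul_right, b.inner_eq_ite]
    by_cases hij : i = j
    · subst hij; simp; ring
    · simp [hij, Ne.symm hij]
  rw [Fintype.sum_prod_type]
  simp only [e, Finset.sum_sub_distrib, Finset.sum_add_distrib, Finset.sum_const, h,
    Finset.sum_ite_eq, Finset.mem_univ, if_true, ← Finset.mul_sum, Finset.card_univ, nsmul_eq_mul]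
  ring

theorem sum_inner_skewPair_sq (x w : V) :
    ∑ k : ι × ι, ⟪skewPair (b k.1) (b k.2) (skewPair (b k.1) (b k.2) x), w⟫_ℝ =
      -(2 * ((Fintype.card ι : ℝ) - 1) * ⟪x, w⟫_ℝ) := by
  rw [← sum_inner_skewPair_skewPair, ← Finset.sum_neg_distrib]
  refine Finset.sum_congr rfl fun k _ => ?_
  rw [real_inner_comm, inner_skewPair_right, real_inner_comm]

end SkewPair

section Generators

variable {p q : ℕ}

/-- The inclusion `x ↦ (x, 0)`. -/
def inclFst : EuclideanSpace ℝ (Fin (p + 1)) →L[ℝ] Ambient p q :=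
  (WithLp.prodContinuousLinearEquiv 2 ℝ (EuclideanSpace ℝ (Fin (p + 1)))
    (EuclideanSpace ℝ (Fin (q + 1)))).symm.toContinuousLinearMap ∘L ContinuousLinearMap.inl ℝ _ _

/-- The inclusion `y ↦ (0, y)`. -/
def inclSnd : EuclideanSpace ℝ (Fin (q + 1)) →L[ℝ] Ambient p q :=
  (WithLp.prodContinuousLinearEquiv 2 ℝ (EuclideanSpace ℝ (Fin (p + 1)))
    (EuclideanSpace ℝ (Fin (q + 1)))).symm.toContinuousLinearMap ∘L ContinuousLinearMap.inr ℝ _ _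

@[simp] theorem inclFst_fst (x : EuclideanSpace ℝ (Fin (p + 1))) :
    (inclFst x : Ambient p q).fst = x := rfl

@[simp] theorem inclFst_snd (x : EuclideanSpace ℝ (Fin (p + 1))) :
    (inclFst x : Ambient p q).snd = 0 := rfl

@[simp] theorem inclSnd_fst (y : EuclideanSpace ℝ (Fin (q + 1))) :
    (inclSnd y : Ambient p q).fst = 0 := rfl

@[simp] theorem inclSnd_snd (y : EuclideanSpace ℝ (Fin (q + 1))) :
    (inclSnd y : Ambient p q).snd = y := rfl

/-- The projection `(x, y) ↦ x`. -/
def projFst : Ambient p q →L[ℝ] EuclideanSpace ℝ (Fin (p + 1)) := WithLp.fstL 2 ℝ _ _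

/-- The projection `(x, y) ↦ y`. -/
def projSnd : Ambient p q →L[ℝ] EuclideanSpace ℝ (Fin (q + 1)) := WithLp.sndL 2 ℝ _ _

@[simp] theorem projFst_apply (z : Ambient p q) : projFst z = z.fst := rfl

@[simp] theorem projSnd_apply (z : Ambient p q) : projSnd z = z.snd := rfl

theorem ambient_inner (z w : Ambient p q) :
    ⟪z, w⟫_ℝ = ⟪z.fst, w.fst⟫_ℝ + ⟪z.snd, w.snd⟫_ℝ := WithLp.prod_inner_apply z w

theorem ambient_ext {z w : Ambient p q} (h₁ : z.fst = w.fst) (h₂ : z.snd = w.snd) : z = w :=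
  WithLp.ofLp_injective 2 (Prod.ext h₁ h₂)

/-- Indices of the coordinate rotations of the two factors. -/
abbrev RotIndex (p q : ℕ) : Type :=
  (Fin (p + 1) × Fin (p + 1)) ⊕ (Fin (q + 1) × Fin (q + 1))

/-- The infinitesimal coordinate rotations of the two factors. -/
def generator : RotIndex p q → Ambient p q →L[ℝ] Ambient p q
  | .inl k => inclFst ∘L skewPair (EuclideanSpace.basisFun _ ℝ k.1)
      (EuclideanSpace.basisFun _ ℝ k.2) ∘L projFst
  | .inr k => inclSnd ∘L skewPair (EuclideanSpace.basisFun _ ℝ k.1)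
      (EuclideanSpace.basisFun _ ℝ k.2) ∘L projSnd

theorem generator_inl (k : Fin (p + 1) × Fin (p + 1)) (z : Ambient p q) :
    generator (.inl k) z = inclFst (skewPair (EuclideanSpace.basisFun _ ℝ k.1)
      (EuclideanSpace.basisFun _ ℝ k.2) z.fst) := rfl

theorem generator_inr (k : Fin (q + 1) × Fin (q + 1)) (z : Ambient p q) :
    generator (.inr k) z = inclSnd (skewPair (EuclideanSpace.basisFun _ ℝ k.1)
      (EuclideanSpace.basisFun _ ℝ k.2) z.snd) := rfl

/-- An endomorphism of `ℝ^{p+1} × ℝ^{q+1}` that is skew-adjoint on both factors. -/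
structure IsBiskew (A : Ambient p q →L[ℝ] Ambient p q) : Prop where
  fst : ∀ z, ⟪z.fst, (A z).fst⟫_ℝ = 0
  snd : ∀ z, ⟪z.snd, (A z).snd⟫_ℝ = 0

theorem isBiskew_generator (k : RotIndex p q) : IsBiskew (generator k) := by
  rcases k with k | k
  · exact ⟨fun z => by rw [generator_inl, inclFst_fst, inner_skewPair_self],
      fun z => by rw [generator_inl, inclFst_snd, inner_zero_right]⟩
  · exact ⟨fun z => by rw [generator_inr, inclSnd_fst, inner_zero_right],
      fun z => by rw [generator_inr, inclSnd_snd, inner_skewPair_self]⟩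

/-- The weight of a coordinate rotation in the Laplace operator of `S^p(r) × S^q(s)`. -/
def weight (r s : ℝ) : RotIndex p q → ℝ
  | .inl _ => (2 * r ^ 2)⁻¹
  | .inr _ => (2 * s ^ 2)⁻¹

theorem sum_weight_mul (r s : ℝ) (F : RotIndex p q → ℝ) :
    ∑ k, weight r s k * F k =
      (2 * r ^ 2)⁻¹ * ∑ k, F (.inl k) + (2 * s ^ 2)⁻¹ * ∑ k, F (.inr k) := by
  rw [Fintype.sum_sum_type, Finset.mul_sum, Finset.mul_sum]
  rfl

theorem sum_weight_inner_mul {r s : ℝ} (hr : r ≠ 0) (hs : s ≠ 0) {z : Ambient p q}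
    (hx : ‖z.fst‖ = r) (hy : ‖z.snd‖ = s) (v w : Ambient p q) :
    ∑ k, weight r s k * (⟪generator k z, v⟫_ℝ * ⟪generator k z, w⟫_ℝ) =
      ⟪v, w⟫_ℝ - ⟪z.fst, v.fst⟫_ℝ * ⟪z.fst, w.fst⟫_ℝ / r ^ 2
        - ⟪z.snd, v.snd⟫_ℝ * ⟪z.snd, w.snd⟫_ℝ / s ^ 2 := by
  rw [sum_weight_mul]
  simp only [generator_inl, generator_inr, ambient_inner, inclFst_fst, inclFst_snd, inclSnd_fst,
    inclSnd_snd, inner_zero_left, add_zero, zero_add]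
  rw [sum_inner_skewPair_mul, sum_inner_skewPair_mul, real_inner_self_eq_norm_sq,
    real_inner_self_eq_norm_sq, hx, hy]
  field_simp
  ring

theorem sum_weight_inner_sq (r s : ℝ) (z w : Ambient p q) :
    ∑ k, weight r s k * ⟪generator k (generator k z), w⟫_ℝ =
      -(p / r ^ 2 * ⟪z.fst, w.fst⟫_ℝ) - q / s ^ 2 * ⟪z.snd, w.snd⟫_ℝ := by
  rw [sum_weight_mul]
  simp only [generator_inl, generator_inr, ambient_inner, inclFst_fst, inclFst_snd, inclSnd_fst,
    inclSnd_snd, inner_zero_left, add_zero, zero_add]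
  rw [sum_inner_skewPair_sq, sum_inner_skewPair_sq]
  simp only [Fintype.card_fin, Nat.cast_add, Nat.cast_one, add_sub_cancel_right]
  rw [mul_inv, mul_inv]
  ring

end Generators

section LieDerivative

variable {E : Type*} [NormedAddCommGroup E] [NormedSpace ℝ E]

/-- The derivative of `f` along the linear vector field `z ↦ A z`. -/
def lieDeriv (A : E →L[ℝ] E) (f : E → ℝ) (z : E) : ℝ :=
  fderiv ℝ f z (A z)

theorem lieDeriv_mul (A : E →L[ℝ] E) {f g : E → ℝ} {z : E} (hf : DifferentiableAt ℝ f z)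
    (hg : DifferentiableAt ℝ g z) :
    lieDeriv A (fun w => f w * g w) z = f z * lieDeriv A g z + g z * lieDeriv A f z := by
  simp [lieDeriv, fderiv_fun_mul hf hg]

theorem lieDeriv_pow (A : E →L[ℝ] E) {f : E → ℝ} {z : E} (hf : DifferentiableAt ℝ f z) (d : ℕ) :
    lieDeriv A (fun w => f w ^ d) z = d * f z ^ (d - 1) * lieDeriv A f z := by
  simp [lieDeriv, fderiv_fun_pow d hf]

theorem contDiffOn_lieDeriv (A : E →L[ℝ] E) {f : E → ℝ} {U : Set E} (hU : IsOpen U)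
    {m n : WithTop ℕ∞} (hf : ContDiffOn ℝ n f U) (hmn : m + 1 ≤ n) :
    ContDiffOn ℝ m (lieDeriv A f) U :=
  (hf.fderiv_of_isOpen hU hmn).clm_apply A.contDiff.contDiffOn

theorem lieDeriv_comp_equiv (A : E →L[ℝ] E) (f : E → ℝ) (δ : E ≃L[ℝ] E)
    (h : ∀ z, δ (A z) = A (δ z)) (z : E) : lieDeriv A (f ∘ δ) z = lieDeriv A f (δ z) := by
  simp [lieDeriv, δ.comp_right_fderiv, h]

variable [CompleteSpace E]

theorem hasDerivAt_exp_smul_apply (A : E →L[ℝ] E) (z : E) (θ : ℝ) :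
    HasDerivAt (fun τ : ℝ => NormedSpace.exp (τ • A) z) (A (NormedSpace.exp (θ • A) z)) θ := by
  have h := (hasDerivAt_exp_smul_const' (𝕂 := ℝ) A θ).clm_apply (hasDerivAt_const θ z)
  simpa using h

end LieDerivative

section Rotation

variable {E : Type*} [NormedAddCommGroup E] [InnerProductSpace ℝ E] [FiniteDimensional ℝ E]
  {F : Type*} [NormedAddCommGroup F] [InnerProductSpace ℝ F]

theorem norm_map_exp_smul {A : E →L[ℝ] E} (P : E →L[ℝ] F) (h : ∀ z, ⟪P z, P (A z)⟫_ℝ = 0)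
    (θ : ℝ) (z : E) : ‖P (NormedSpace.exp (θ • A) z)‖ = ‖P z‖ := by
  have h₀ : NormedSpace.exp ((0 : ℝ) • A) z = z := by
    rw [zero_smul, NormedSpace.exp_zero, one_apply_eq_self]
  have h₁ : ∀ τ, HasDerivAt (fun τ : ℝ => ‖P (NormedSpace.exp (τ • A) z)‖ ^ 2) 0 τ := fun τ => by
    have h₂ := (P.hasFDerivAt.comp_hasDerivAt τ (hasDerivAt_exp_smul_apply A z τ)).norm_sq
    simpa [h] using h₂
  have h₂ := is_const_of_deriv_eq_zero (fun τ => (h₁ τ).differentiableAt)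
    (fun τ => (h₁ τ).deriv) θ 0
  rwa [h₀, sq_eq_sq₀ (norm_nonneg _) (norm_nonneg _)] at h₂

/-- The rotation `exp (θ A)` generated by a skew-adjoint map `A`. -/
def rotation {A : E →L[ℝ] E} (hA : ∀ z, ⟪z, A z⟫_ℝ = 0) (θ : ℝ) : E ≃ₗᵢ[ℝ] E :=
  LinearIsometry.toLinearIsometryEquiv
    { toLinearMap := (NormedSpace.exp (θ • A) : E →L[ℝ] E).toLinearMap
      norm_map' := norm_map_exp_smul (ContinuousLinearMap.id ℝ E) hA θ } rfl

theorem rotation_apply {A : E →L[ℝ] E} (hA : ∀ z, ⟪z, A z⟫_ℝ = 0) (θ : ℝ) (z : E) :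
    rotation hA θ z = NormedSpace.exp (θ • A) z := rfl

theorem rotation_zero_apply {A : E →L[ℝ] E} (hA : ∀ z, ⟪z, A z⟫_ℝ = 0) (z : E) :
    rotation hA 0 z = z := by
  rw [rotation_apply, zero_smul, NormedSpace.exp_zero, one_apply_eq_self]

theorem hasDerivAt_rotation {A : E →L[ℝ] E} (hA : ∀ z, ⟪z, A z⟫_ℝ = 0) (z : E) (θ : ℝ) :
    HasDerivAt (fun τ => rotation hA τ z) (A (rotation hA θ z)) θ :=
  hasDerivAt_exp_smul_apply A z θ

theorem setIntegral_lieDeriv_eq_zero_of_mapsTo [MeasurableSpace E] [BorelSpace E]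
    {A : E →L[ℝ] E} (hA : ∀ z, ⟪z, A z⟫_ℝ = 0) {K U : Set E} (hK : IsCompact K) (hU : IsOpen U)
    (hKU : K ⊆ U) (hRK : ∀ θ, rotation hA θ ⁻¹' K = K) {f : E → ℝ} (hf : ContDiffOn ℝ 1 f U) :
    ∫ z in K, lieDeriv A f z = 0 := by
  have hL : ContinuousOn (lieDeriv A f) U :=
    (contDiffOn_lieDeriv A hU (m := 0) hf (by norm_num)).continuousOn
  have hmem : ∀ θ, MapsTo (rotation hA θ) K K := fun θ z hz => by
    rw [← hRK θ] at hz
    exact hz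
  have hmeas : MeasurableSet K := hK.measurableSet
  have hcomp : ∀ (g : E → ℝ) (θ : ℝ), ContinuousOn g U →
      ContinuousOn (fun z => g (rotation hA θ z)) K := fun g θ hg =>
    (hg.mono hKU).comp (rotation hA θ).continuous.continuousOn (hmem θ)
  obtain ⟨C, hC⟩ := hK.exists_bound_of_continuousOn (hL.mono hKU)
  have hderiv : ∀ z ∈ K, ∀ θ ∈ (univ : Set ℝ),
      HasDerivAt (fun τ => f (rotation hA τ z)) (lieDeriv A f (rotation hA θ z)) θ := by
    intro z hz θ _
    have h₁ : HasFDerivAt f (fderiv ℝ f (rotation hA θ z)) (rotation hA θ z) :=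
      ((hf.contDiffAt (hU.mem_nhds (hKU (hmem θ hz)))).differentiableAt one_ne_zero).hasFDerivAt
    exact h₁.comp_hasDerivAt θ (hasDerivAt_rotation hA z θ)
  have key := hasDerivAt_integral_of_dominated_loc_of_deriv_le
    (μ := volume.restrict K) (F := fun θ z => f (rotation hA θ z))
    (F' := fun θ z => lieDeriv A f (rotation hA θ z)) (x₀ := (0 : ℝ)) (s := univ)
    (bound := fun _ => C) Filter.univ_mem
    (Filter.Eventually.of_forall fun θ => (hcomp f θ hf.continuousOn).aestronglyMeasurable hmeas)
    ((hcomp f 0 hf.continuousOn).integrableOn_compact hK)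
    ((hcomp _ 0 hL).aestronglyMeasurable hmeas)
    (ae_restrict_of_forall_mem hmeas fun z hz θ _ => hC _ (hmem θ hz))
    (integrableOn_const hK.measure_lt_top.ne)
    (ae_restrict_of_forall_mem hmeas hderiv)
  have hinv : ∀ (θ : ℝ) (g : E → ℝ), ∫ z in K, g (rotation hA θ z) = ∫ z in K, g z := by
    intro θ g
    have h₃ := (rotation hA θ).measurePreserving.setIntegral_preimage_emb
      (rotation hA θ).toHomeomorph.measurableEmbedding g K
    rwa [hRK] at h₃
  have h := key.2
  simp only [hinv] at h
  exact h.unique (hasDerivAt_const _ _)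

end Rotation

section Shell

variable {p q : ℕ}

theorem IsBiskew.inner_self {A : Ambient p q →L[ℝ] Ambient p q} (hA : IsBiskew A)
    (z : Ambient p q) : ⟪z, A z⟫_ℝ = 0 := by
  rw [ambient_inner, hA.fst, hA.snd, add_zero]

theorem norm_fst_rotation {A : Ambient p q →L[ℝ] Ambient p q} (hA : IsBiskew A) (θ : ℝ)
    (z : Ambient p q) : ‖(rotation hA.inner_self θ z).fst‖ = ‖z.fst‖ :=
  norm_map_exp_smul projFst hA.fst θ z

theorem norm_snd_rotation {A : Ambient p q →L[ℝ] Ambient p q} (hA : IsBiskew A) (θ : ℝ)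
    (z : Ambient p q) : ‖(rotation hA.inner_self θ z).snd‖ = ‖z.snd‖ :=
  norm_map_exp_smul projSnd hA.snd θ z

/-- The set of points both of whose components are nonzero. -/
def punctured (p q : ℕ) : Set (Ambient p q) := {z | z.fst ≠ 0 ∧ z.snd ≠ 0}

/-- The product of two closed shells of radii `1` and `2`. -/
def shell (p q : ℕ) : Set (Ambient p q) :=
  {z | (1 ≤ ‖z.fst‖ ∧ ‖z.fst‖ ≤ 2) ∧ 1 ≤ ‖z.snd‖ ∧ ‖z.snd‖ ≤ 2}

@[fun_prop]
theorem continuous_norm_fst : Continuous fun z : Ambient p q => ‖z.fst‖ :=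
  projFst.continuous.norm

@[fun_prop]
theorem continuous_norm_snd : Continuous fun z : Ambient p q => ‖z.snd‖ :=
  projSnd.continuous.norm

theorem isOpen_punctured : IsOpen (punctured p q) :=
  (isOpen_ne_fun projFst.continuous continuous_const).inter
    (isOpen_ne_fun projSnd.continuous continuous_const)

theorem isCompact_shell : IsCompact (shell p q) := by
  refine Metric.isCompact_of_isClosed_isBounded ?_ ?_
  · exact ((isClosed_le continuous_const continuous_norm_fst).inter
      (isClosed_le continuous_norm_fst continuous_const)).inter
      ((isClosed_le continuous_const continuous_norm_snd).inter
      (isClosed_le continuous_norm_snd continuous_const))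
  · refine (Metric.isBounded_closedBall (x := (0 : Ambient p q)) (r := 4)).subset fun z hz => ?_
    have h := WithLp.prod_norm_sq_eq_of_L2 z
    have h₁ := hz.1.2
    have h₂ := hz.2.2
    have h₃ := norm_nonneg z.fst
    have h₄ := norm_nonneg z.snd
    rw [mem_closedBall_zero_iff]
    nlinarith [norm_nonneg z]

theorem shell_subset_punctured : shell p q ⊆ punctured p q := fun _ hz =>
  ⟨norm_pos_iff.1 (one_pos.trans_le hz.1.1), norm_pos_iff.1 (one_pos.trans_le hz.2.1)⟩

theorem setIntegral_shell_comp (R : Ambient p q ≃ₗᵢ[ℝ] Ambient p q)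
    (h₁ : ∀ z, ‖(R z).fst‖ = ‖z.fst‖) (h₂ : ∀ z, ‖(R z).snd‖ = ‖z.snd‖) (f : Ambient p q → ℝ) :
    ∫ z in shell p q, f (R z) = ∫ z in shell p q, f z := by
  have h : R ⁻¹' shell p q = shell p q := by
    ext z
    simp [shell, h₁, h₂]
  have h₃ := R.measurePreserving.setIntegral_preimage_emb
    R.toHomeomorph.measurableEmbedding f (shell p q)
  rwa [h] at h₃

theorem integrableOn_shell {f : Ambient p q → ℝ}
    (hf : ContinuousOn f (punctured p q)) : IntegrableOn f (shell p q) :=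
  (hf.mono shell_subset_punctured).integrableOn_compact isCompact_shell

theorem setIntegral_lieDeriv_eq_zero {A : Ambient p q →L[ℝ] Ambient p q} (hA : IsBiskew A)
    {f : Ambient p q → ℝ} (hf : ContDiffOn ℝ 1 f (punctured p q)) :
    ∫ z in shell p q, lieDeriv A f z = 0 := by
  refine setIntegral_lieDeriv_eq_zero_of_mapsTo hA.inner_self isCompact_shell isOpen_punctured
    shell_subset_punctured (fun θ => ?_) hf
  ext z
  simp [shell, norm_fst_rotation hA, norm_snd_rotation hA]

theorem setIntegral_lieDeriv_mul {A : Ambient p q →L[ℝ] Ambient p q} (hA : IsBiskew A)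
    {f g : Ambient p q → ℝ} (hf : ContDiffOn ℝ 1 f (punctured p q))
    (hg : ContDiffOn ℝ 1 g (punctured p q)) :
    ∫ z in shell p q, lieDeriv A f z * g z = -∫ z in shell p q, f z * lieDeriv A g z := by
  have hc : ∀ {h : Ambient p q → ℝ}, ContDiffOn ℝ 1 h (punctured p q) →
      ContinuousOn (lieDeriv A h) (punctured p q) := fun hh =>
    (contDiffOn_lieDeriv A isOpen_punctured (m := 0) hh (by norm_num)).continuousOn
  have hd : ∀ {h : Ambient p q → ℝ}, ContDiffOn ℝ 1 h (punctured p q) → ∀ z ∈ shell p q,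
      DifferentiableAt ℝ h z := fun hh z hz => (hh.contDiffAt (isOpen_punctured.mem_nhds
        (shell_subset_punctured hz))).differentiableAt one_ne_zero
  have h₁ : IntegrableOn (fun z => lieDeriv A f z * g z) (shell p q) :=
    integrableOn_shell ((hc hf).mul hg.continuousOn)
  have h₂ : IntegrableOn (fun z => f z * lieDeriv A g z) (shell p q) :=
    integrableOn_shell (hf.continuousOn.mul (hc hg))
  rw [eq_neg_iff_add_eq_zero, ← integral_add h₁ h₂, ← setIntegral_lieDeriv_eq_zero hA (hf.mul hg)]
  refine setIntegral_congr_fun isCompact_shell.measurableSet fun z hz => ?_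
  change _ = lieDeriv A (fun w => f w * g w) z
  rw [lieDeriv_mul A (hd hf z hz) (hd hg z hz)]
  ring

theorem setIntegral_lieDeriv_lieDeriv_mul {A : Ambient p q →L[ℝ] Ambient p q} (hA : IsBiskew A)
    {f g : Ambient p q → ℝ} (hf : ContDiffOn ℝ 2 f (punctured p q))
    (hg : ContDiffOn ℝ 2 g (punctured p q)) :
    ∫ z in shell p q, lieDeriv A (lieDeriv A f) z * g z =
      ∫ z in shell p q, f z * lieDeriv A (lieDeriv A g) z := by
  have h12 : (1 : WithTop ℕ∞) + 1 ≤ 2 := by norm_num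
  have hf' := contDiffOn_lieDeriv A isOpen_punctured hf h12
  have hg' := contDiffOn_lieDeriv A isOpen_punctured hg h12
  rw [setIntegral_lieDeriv_mul hA hf' (hg.of_le (by norm_num)),
    setIntegral_lieDeriv_mul hA (hf.of_le (by norm_num)) hg', neg_neg]

end Shell

section TangentialCalculus

variable {E : Type*} [NormedAddCommGroup E] [InnerProductSpace ℝ E]
  {F : Type*} [NormedAddCommGroup F] [NormedSpace ℝ F]

theorem HasFDerivWithinAt.eqOn_tangentPlane {S : Set E} {z : E} {f : E → F} {f₁ f₂ : E →L[ℝ] F}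
    (h₁ : HasFDerivWithinAt f f₁ S z) (h₂ : HasFDerivWithinAt f f₂ S z) {v : E}
    (hv : v ∈ tangentPlane S z) : f₁ v = f₂ v :=
  LinearMap.eqOn_span (f := f₁.toLinearMap) (g := f₂.toLinearMap) (h₁.unique_on h₂) hv

theorem fderivWithin_apply_of_eqOn {S : Set E} {z : E} (hz : z ∈ S) {f g : E → F}
    (hfg : EqOn f g S) {g' : E →L[ℝ] F} (hg : HasFDerivAt g g' z) {v : E}
    (hv : v ∈ tangentPlane S z) : fderivWithin ℝ f S z v = g' v := by
  have h : HasFDerivWithinAt f g' S z := hg.hasFDerivWithinAt.congr hfg (hfg hz)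
  exact HasFDerivWithinAt.eqOn_tangentPlane h.differentiableWithinAt.hasFDerivWithinAt h hv

theorem lieDeriv_inner_self (A : E →L[ℝ] E) {X : E → E} {z : E} (hX : DifferentiableAt ℝ X z) :
    lieDeriv A (fun w => ⟪X w, A w⟫_ℝ) z =
      ⟪A (A z), X z⟫_ℝ + ⟪A z, fderiv ℝ X z (A z)⟫_ℝ := by
  rw [lieDeriv, fderiv_inner_apply ℝ hX A.differentiableAt, ContinuousLinearMap.fderiv,
    real_inner_comm, real_inner_comm (A z)]

variable [FiniteDimensional ℝ E]

theorem trace_eq_sum_of_resolution {ι : Type*} [Fintype ι] (c : ι → ℝ) (v : ι → E)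
    (h : ∀ x, ∑ k, (c k * ⟪v k, x⟫_ℝ) • v k = x) (B : E →ₗ[ℝ] E) :
    LinearMap.trace ℝ E B = ∑ k, c k * ⟪v k, B (v k)⟫_ℝ := by
  have hB : B = ∑ k, c k • ((innerSL ℝ (v k)).toLinearMap.smulRight (v k)) ∘ₗ B := by
    ext x
    conv_lhs => rw [← h (B x)]
    simp [mul_smul]
  have h₂ : ∀ k, ((innerSL ℝ (v k)).toLinearMap.smulRight (v k)) ∘ₗ B =
      ((innerSL ℝ (v k)).toLinearMap ∘ₗ B).smulRight (v k) := fun k => by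
    ext x
    simp
  conv_lhs => rw [hB]
  simp only [map_sum, map_smul, h₂, LinearMap.trace_smulRight, smul_eq_mul]
  rfl

theorem trace_submodule_eq_sum {ι : Type*} [Fintype ι] {T : Submodule ℝ E} (c : ι → ℝ)
    {v : ι → E} (hv : ∀ k, v k ∈ T) (h : ∀ x ∈ T, ∑ k, (c k * ⟪v k, x⟫_ℝ) • v k = x)
    (B : T →ₗ[ℝ] T) :
    LinearMap.trace ℝ T B = ∑ k, c k * ⟪(⟨v k, hv k⟩ : T), B ⟨v k, hv k⟩⟫_ℝ := by
  refine trace_eq_sum_of_resolution c (fun k => (⟨v k, hv k⟩ : T)) (fun x => Subtype.ext ?_) B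
  rw [AddSubmonoidClass.coe_finsetSum]
  exact h x x.2

theorem differentiableAt_gradient {f : E → ℝ} {z : E} (hf : ContDiffAt ℝ 2 f z) :
    DifferentiableAt ℝ (gradient f) z :=
  (InnerProductSpace.toDual ℝ E).symm.toContinuousLinearEquiv.differentiableAt.comp z
    ((hf.fderiv_right (m := 1) (by norm_num)).differentiableAt one_ne_zero)

theorem mem_tangentPlane_of_rotation {A : E →L[ℝ] E} (hA : ∀ z, ⟪z, A z⟫_ℝ = 0) {S : Set E}
    {z : E} (h : ∀ θ, rotation hA θ z ∈ S) : A z ∈ tangentPlane S z := by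
  have h₁ := (hasDerivAt_rotation hA z 0).hasFDerivAt.hasFDerivWithinAt (s := univ)
  have h₂ := h₁.mapsTo_tangent_cone (show (1 : ℝ) ∈ _ by rw [tangentConeAt_univ]; trivial)
  rw [rotation_zero_apply] at h₂
  simp only [ContinuousLinearMap.toSpanSingleton_apply, one_smul] at h₂
  refine Submodule.subset_span (tangentConeAt_mono ?_ h₂)
  rintro _ ⟨θ, -, rfl⟩
  exact h θ

theorem inner_gradient_left (f : E → ℝ) (z v : E) : ⟪gradient f z, v⟫_ℝ = fderiv ℝ f z v := by
  simp [gradient]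

theorem inner_covDeriv {S : Set E} {z : E} (hz : z ∈ S) {X Y : E → E} (hXY : EqOn X Y S)
    {Y' : E →L[ℝ] E} (hY : HasFDerivAt Y Y' z) (v w : tangentPlane S z) :
    ⟪v, covDeriv S X z w⟫_ℝ = ⟪(v : E), Y' w⟫_ℝ := by
  rw [← fderivWithin_apply_of_eqOn hz hXY hY w.2]
  exact (tangentPlane S z).inner_orthogonalProjectionOnto_eq_of_mem_left v _

theorem gradOn_eq {S : Set E} {z : E} (hz : z ∈ S) {u U : E → ℝ} (huU : EqOn u U S)
    (hU : DifferentiableAt ℝ U z) :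
    gradOn S u z = (tangentPlane S z).starProjection (gradient U z) := by
  rw [gradOn, ← sub_eq_zero, ← map_sub, Submodule.starProjection_apply_eq_zero_iff,
    Submodule.mem_orthogonal]
  intro v hv
  rw [inner_sub_right, real_inner_comm, real_inner_comm _ v, inner_gradient_left,
    ← fderivWithin_apply_of_eqOn hz huU hU.hasFDerivAt hv]
  simp [gradientWithin]

end TangentialCalculus

section Hypersurface

variable {p q : ℕ} {t : ℝ} {z : Ambient p q}

theorem generator_mem_tangentPlane (hz : z ∈ hypersurface p q t) (k : RotIndex p q) :
    generator k z ∈ tangentPlane (hypersurface p q t) z :=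
  mem_tangentPlane_of_rotation (isBiskew_generator k).inner_self fun θ => by
    rw [hypersurface, mem_ofPred_eq, norm_fst_rotation (isBiskew_generator k),
      norm_snd_rotation (isBiskew_generator k)]
    exact hz

theorem sum_weight_smul_generator (hc : Real.cos t ≠ 0) (hs : Real.sin t ≠ 0)
    (hz : z ∈ hypersurface p q t) {v : Ambient p q} (h₁ : ⟪z.fst, v.fst⟫_ℝ = 0)
    (h₂ : ⟪z.snd, v.snd⟫_ℝ = 0) :
    ∑ k, (weight (Real.cos t) (Real.sin t) k * ⟪generator k z, v⟫_ℝ) • generator k z = v := by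
  refine ext_inner_right ℝ fun w => ?_
  have h := sum_weight_inner_mul hc hs hz.1 hz.2 v w
  rw [h₁, h₂, zero_mul, zero_mul, zero_div, zero_div, sub_zero, sub_zero] at h
  rw [← h, sum_inner]
  exact Finset.sum_congr rfl fun k _ => by rw [real_inner_smul_left, mul_assoc]

theorem mem_tangentPlane_iff (hc : Real.cos t ≠ 0) (hs : Real.sin t ≠ 0)
    (hz : z ∈ hypersurface p q t) {v : Ambient p q} :
    v ∈ tangentPlane (hypersurface p q t) z ↔ ⟪z.fst, v.fst⟫_ℝ = 0 ∧ ⟪z.snd, v.snd⟫_ℝ = 0 := by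
  constructor
  · intro hv
    constructor
    · have h₁ := (projFst (p := p) (q := q).hasFDerivAt (x := z)).norm_sq.hasFDerivWithinAt
        (s := hypersurface p q t)
      have h₂ : HasFDerivWithinAt (fun w : Ambient p q => ‖projFst w‖ ^ 2)
          (0 : Ambient p q →L[ℝ] ℝ) (hypersurface p q t) z :=
        (hasFDerivWithinAt_const (Real.cos t ^ 2) z _).congr
          (fun w hw => by rw [projFst_apply, hw.1]) (by rw [projFst_apply, hz.1])
      simpa using HasFDerivWithinAt.eqOn_tangentPlane h₁ h₂ hv
    · have h₁ := (projSnd (p := p) (q := q).hasFDerivAt (x := z)).norm_sq.hasFDerivWithinAt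
        (s := hypersurface p q t)
      have h₂ : HasFDerivWithinAt (fun w : Ambient p q => ‖projSnd w‖ ^ 2)
          (0 : Ambient p q →L[ℝ] ℝ) (hypersurface p q t) z :=
        (hasFDerivWithinAt_const (Real.sin t ^ 2) z _).congr
          (fun w hw => by rw [projSnd_apply, hw.2]) (by rw [projSnd_apply, hz.2])
      simpa using HasFDerivWithinAt.eqOn_tangentPlane h₁ h₂ hv
  · rintro ⟨h₁, h₂⟩
    rw [← sum_weight_smul_generator hc hs hz h₁ h₂]
    exact Submodule.sum_mem _ fun k _ => Submodule.smul_mem _ _ (generator_mem_tangentPlane hz k)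

theorem trace_tangentPlane (hc : Real.cos t ≠ 0) (hs : Real.sin t ≠ 0)
    (hz : z ∈ hypersurface p q t)
    (B : tangentPlane (hypersurface p q t) z →ₗ[ℝ] tangentPlane (hypersurface p q t) z) :
    LinearMap.trace ℝ _ B = ∑ k, weight (Real.cos t) (Real.sin t) k *
      ⟪(⟨generator k z, generator_mem_tangentPlane hz k⟩ : tangentPlane (hypersurface p q t) z),
        B ⟨generator k z, generator_mem_tangentPlane hz k⟩⟫_ℝ := by
  refine trace_submodule_eq_sum _ (generator_mem_tangentPlane hz) (fun v hv => ?_) B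
  have h := (mem_tangentPlane_iff hc hs hz).1 hv
  exact sum_weight_smul_generator hc hs hz h.1 h.2

/-- The orthogonal projection onto the tangent space of `S^p(r) × S^q(s)` at `w`. -/
def tangentProj (r s : ℝ) (w g : Ambient p q) : Ambient p q :=
  g - (⟪projFst w, projFst g⟫_ℝ / r ^ 2) • inclFst (projFst w)
    - (⟪projSnd w, projSnd g⟫_ℝ / s ^ 2) • inclSnd (projSnd w)

theorem tangentProj_fst (r s : ℝ) (w g : Ambient p q) :
    (tangentProj r s w g).fst = g.fst - (⟪w.fst, g.fst⟫_ℝ / r ^ 2) • w.fst := by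
  simp [tangentProj]

theorem tangentProj_snd (r s : ℝ) (w g : Ambient p q) :
    (tangentProj r s w g).snd = g.snd - (⟪w.snd, g.snd⟫_ℝ / s ^ 2) • w.snd := by
  simp [tangentProj]

theorem starProjection_tangentPlane (hc : Real.cos t ≠ 0) (hs : Real.sin t ≠ 0)
    (hz : z ∈ hypersurface p q t) (g : Ambient p q) :
    (tangentPlane (hypersurface p q t) z).starProjection g =
      tangentProj (Real.cos t) (Real.sin t) z g := by
  refine Submodule.eq_starProjection_of_mem_of_inner_eq_zero ?_ fun w hw => ?_
  · rw [mem_tangentPlane_iff hc hs hz, tangentProj_fst, tangentProj_snd]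
    simp only [inner_sub_right, inner_smul_right, real_inner_self_eq_norm_sq, hz.1, hz.2]
    constructor <;> field_simp <;> ring
  · rw [mem_tangentPlane_iff hc hs hz] at hw
    rw [ambient_inner, WithLp.sub_fst, WithLp.sub_snd, tangentProj_fst, tangentProj_snd]
    simp [inner_smul_left, hw.1, hw.2]

theorem differentiableAt_tangentProj (r s : ℝ) {g : Ambient p q → Ambient p q}
    (hg : DifferentiableAt ℝ g z) : DifferentiableAt ℝ (fun w => tangentProj r s w (g w)) z := by
  have h₁ : DifferentiableAt ℝ (fun w => ⟪projFst w, projFst (g w)⟫_ℝ) z :=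
    projFst.differentiableAt.inner ℝ (projFst.differentiableAt.comp z hg)
  have h₂ : DifferentiableAt ℝ (fun w => ⟪projSnd w, projSnd (g w)⟫_ℝ) z :=
    projSnd.differentiableAt.inner ℝ (projSnd.differentiableAt.comp z hg)
  unfold tangentProj
  fun_prop

theorem inner_tangentProj_of_isBiskew {A : Ambient p q →L[ℝ] Ambient p q} (hA : IsBiskew A)
    (r s : ℝ) (w g : Ambient p q) : ⟪tangentProj r s w g, A w⟫_ℝ = ⟪g, A w⟫_ℝ := by
  rw [ambient_inner, ambient_inner, tangentProj_fst, tangentProj_snd, inner_sub_left,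
    inner_sub_left, real_inner_smul_left, real_inner_smul_left, hA.fst, hA.snd]
  simp

theorem sqNormSecondForm_hypersurface (hc : Real.cos t ≠ 0) (hs : Real.sin t ≠ 0)
    (hz : z ∈ hypersurface p q t) :
    sqNormSecondForm (hypersurface p q t) (normal p q t) z =
      p * (Real.sin t / Real.cos t) ^ 2 + q * (Real.cos t / Real.sin t) ^ 2 := by
  set M : Ambient p q →L[ℝ] Ambient p q :=
    (Real.sin t / Real.cos t) • (inclFst ∘L projFst)
      - (Real.cos t / Real.sin t) • (inclSnd ∘L projSnd) with hM
  have hM₁ : ∀ w, (M w).fst = (Real.sin t / Real.cos t) • w.fst := fun w => by simp [hM]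
  have hM₂ : ∀ w, (M w).snd = -(Real.cos t / Real.sin t) • w.snd := fun w => by simp [hM]
  have hN : EqOn (normal p q t) M (hypersurface p q t) := fun w hw => by
    refine ambient_ext ?_ ?_
    · rw [hM₁, ← hw.1]; rfl
    · rw [hM₂, ← hw.2]; rfl
  have hshape : ∀ v : tangentPlane (hypersurface p q t) z,
      ((shape (hypersurface p q t) (normal p q t) z v : _) : Ambient p q) = -M v := fun v => by
    have hv := (mem_tangentPlane_iff hc hs hz).1 v.2
    have hMv : M v ∈ tangentPlane (hypersurface p q t) z := by
      rw [mem_tangentPlane_iff hc hs hz, hM₁, hM₂, inner_smul_right, inner_smul_right, hv.1, hv.2,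
        mul_zero, mul_zero]
      exact ⟨rfl, rfl⟩
    have h := Submodule.starProjection_eq_self_iff.2 hMv
    rw [← fderivWithin_apply_of_eqOn hz hN M.hasFDerivAt v.2] at h ⊢
    exact congrArg Neg.neg h
  rw [sqNormSecondForm, trace_tangentPlane hc hs hz]
  simp only [LinearMap.comp_apply, LinearMap.adjoint_inner_right, Submodule.coe_inner, hshape,
    inner_neg_neg]
  rw [sum_weight_mul]
  simp only [ambient_inner, hM₁, hM₂, generator_inl, generator_inr, inclFst_fst, inclFst_snd,
    inclSnd_fst, inclSnd_snd, smul_zero, inner_zero_left, add_zero, zero_add, real_inner_smul_left,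
    real_inner_smul_right, ← Finset.mul_sum, sum_inner_skewPair_skewPair,
    Fintype.card_fin]
  rw [real_inner_self_eq_norm_sq, real_inner_self_eq_norm_sq, hz.1, hz.2]
  push_cast
  field_simp
  ring

theorem laplaceOn_hypersurface (hc : Real.cos t ≠ 0) (hs : Real.sin t ≠ 0)
    {u U : Ambient p q → ℝ} {O : Set (Ambient p q)} (hO : IsOpen O)
    (hSO : hypersurface p q t ⊆ O) (hU : ContDiffOn ℝ 2 U O)
    (huU : EqOn u U (hypersurface p q t)) (hz : z ∈ hypersurface p q t) :
    laplaceOn (hypersurface p q t) u z = ∑ k, weight (Real.cos t) (Real.sin t) k *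
      lieDeriv (generator k) (lieDeriv (generator k) U) z := by
  have hX : EqOn (gradOn (hypersurface p q t) u)
      (fun w => tangentProj (Real.cos t) (Real.sin t) w (gradient U w)) (hypersurface p q t) := by
    intro w hw
    rw [gradOn_eq hw huU ((hU.contDiffAt (hO.mem_nhds (hSO hw))).differentiableAt two_ne_zero),
      starProjection_tangentPlane hc hs hw]
  have hXd : DifferentiableAt ℝ
      (fun w => tangentProj (Real.cos t) (Real.sin t) w (gradient U w)) z :=
    differentiableAt_tangentProj _ _
      (differentiableAt_gradient (hU.contDiffAt (hO.mem_nhds (hSO hz))))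
  set X := fun w => tangentProj (Real.cos t) (Real.sin t) w (gradient U w) with hXdef
  have hLL : ∀ k, lieDeriv (generator k) (lieDeriv (generator k) U) z =
      ⟪generator k (generator k z), X z⟫_ℝ + ⟪generator k z, fderiv ℝ X z (generator k z)⟫_ℝ := by
    intro k
    have h₁ : lieDeriv (generator k) U = fun w => ⟪X w, generator k w⟫_ℝ := funext fun w => by
      rw [hXdef, inner_tangentProj_of_isBiskew (isBiskew_generator k), inner_gradient_left,
        lieDeriv]
    rw [h₁, lieDeriv_inner_self _ hXd]
  have hXz : X z ∈ tangentPlane (hypersurface p q t) z := by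
    change tangentProj _ _ z (gradient U z) ∈ _
    rw [← starProjection_tangentPlane hc hs hz]
    exact Submodule.starProjection_apply_mem _ _
  rw [mem_tangentPlane_iff hc hs hz] at hXz
  rw [laplaceOn, divOn, trace_tangentPlane hc hs hz]
  simp only [inner_covDeriv hz hX hXd.hasFDerivAt, hLL, mul_add, Finset.sum_add_distrib]
  rw [sum_weight_inner_sq, hXz.1, hXz.2]
  simp

theorem finrank_ambient : Module.finrank ℝ (Ambient p q) = p + q + 2 := by
  rw [(WithLp.linearEquiv 2 ℝ _).finrank_eq, Module.finrank_prod, finrank_euclideanSpace_fin,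
    finrank_euclideanSpace_fin]
  ring

end Hypersurface

section RadialExtension

variable {p q : ℕ}

theorem tStar_pos (hp : 1 ≤ p) (hq : 1 ≤ q) : 0 < tStar p q :=
  Real.arctan_pos.2 (Real.sqrt_pos.2 (div_pos (by exact_mod_cast hq) (by exact_mod_cast hp)))

theorem cos_tStar_pos (p q : ℕ) : 0 < Real.cos (tStar p q) := Real.cos_arctan_pos _

theorem sin_tStar_pos (hp : 1 ≤ p) (hq : 1 ≤ q) : 0 < Real.sin (tStar p q) :=
  Real.sin_pos_of_pos_of_lt_pi (tStar_pos hp hq)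
    ((Real.arctan_lt_pi_div_two _).trans (by linarith [Real.pi_pos]))

theorem cos_tStar_sq (hp : 1 ≤ p) : Real.cos (tStar p q) ^ 2 = p / (p + q) := by
  have hp' : (0 : ℝ) < p := by exact_mod_cast hp
  rw [tStar, Real.cos_sq_arctan, Real.sq_sqrt (by positivity)]
  field_simp

theorem sin_tStar_sq (hp : 1 ≤ p) : Real.sin (tStar p q) ^ 2 = q / (p + q) := by
  have hp' : (0 : ℝ) < p := by exact_mod_cast hp
  rw [Real.sin_sq, cos_tStar_sq hp]
  field_simp
  ring

/-- The linear map `(x, y) ↦ (α x, β y)`. -/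
def scale (α β : ℝ) : Ambient p q →L[ℝ] Ambient p q :=
  α • (inclFst ∘L projFst) + β • (inclSnd ∘L projSnd)

@[simp] theorem scale_fst (α β : ℝ) (z : Ambient p q) : (scale α β z).fst = α • z.fst := by
  simp [scale]

@[simp] theorem scale_snd (α β : ℝ) (z : Ambient p q) : (scale α β z).snd = β • z.snd := by
  simp [scale]

/-- `scale α β` as an equivalence, for nonzero factors. -/
def scaleEquiv {α β : ℝ} (hα : α ≠ 0) (hβ : β ≠ 0) : Ambient p q ≃L[ℝ] Ambient p q :=
  ContinuousLinearEquiv.equivOfInverse (scale α β) (scale α⁻¹ β⁻¹)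
    (fun z => ambient_ext (by simp [smul_smul, hα]) (by simp [smul_smul, hβ]))
    (fun z => ambient_ext (by simp [smul_smul, hα]) (by simp [smul_smul, hβ]))

theorem scaleEquiv_apply {α β : ℝ} (hα : α ≠ 0) (hβ : β ≠ 0) (z : Ambient p q) :
    scaleEquiv hα hβ z = scale α β z := rfl

theorem scale_generator (α β : ℝ) (k : RotIndex p q) (z : Ambient p q) :
    scale α β (generator k z) = generator k (scale α β z) := by
  rcases k with k | k
  · refine ambient_ext ?_ ?_ <;> simp [generator_inl]
  · refine ambient_ext ?_ ?_ <;> simp [generator_inr]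

/-- The radial retraction `(x, y) ↦ (r x / ‖x‖, s y / ‖y‖)`. -/
def retract (r s : ℝ) (z : Ambient p q) : Ambient p q :=
  (r / ‖z.fst‖) • inclFst (projFst z) + (s / ‖z.snd‖) • inclSnd (projSnd z)

@[simp] theorem retract_fst (r s : ℝ) (z : Ambient p q) :
    (retract r s z).fst = (r / ‖z.fst‖) • z.fst := by
  simp [retract]

@[simp] theorem retract_snd (r s : ℝ) (z : Ambient p q) :
    (retract r s z).snd = (s / ‖z.snd‖) • z.snd := by
  simp [retract]

theorem retract_eq_scale (r s : ℝ) (z : Ambient p q) :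
    retract r s z = scale (r / ‖z.fst‖) (s / ‖z.snd‖) z := by
  refine ambient_ext ?_ ?_ <;> simp

theorem retract_scale {α β : ℝ} (hα : 0 < α) (hβ : 0 < β) (r s : ℝ) (z : Ambient p q) :
    retract r s (scale α β z) = retract r s z := by
  refine ambient_ext ?_ ?_
  · rw [retract_fst, retract_fst, scale_fst, norm_smul, Real.norm_of_nonneg hα.le, smul_smul]
    congr 1
    field_simp
  · rw [retract_snd, retract_snd, scale_snd, norm_smul, Real.norm_of_nonneg hβ.le, smul_smul]
    congr 1
    field_simp

theorem contDiffOn_retract (r s : ℝ) {n : WithTop ℕ∞} :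
    ContDiffOn ℝ n (retract r s : Ambient p q → Ambient p q) (punctured p q) := by
  intro z hz
  have h₁ : ContDiffAt ℝ n (fun w : Ambient p q => ‖w.fst‖) z :=
    (contDiffAt_norm ℝ hz.1).comp z projFst.contDiff.contDiffAt
  have h₂ : ContDiffAt ℝ n (fun w : Ambient p q => ‖w.snd‖) z :=
    (contDiffAt_norm ℝ hz.2).comp z projSnd.contDiff.contDiffAt
  refine ContDiffAt.contDiffWithinAt (ContDiffAt.add ?_ ?_)
  · exact (contDiffAt_const.div h₁ (norm_ne_zero_iff.2 hz.1)).smul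
      (inclFst ∘L projFst).contDiff.contDiffAt
  · exact (contDiffAt_const.div h₂ (norm_ne_zero_iff.2 hz.2)).smul
      (inclSnd ∘L projSnd).contDiff.contDiffAt

variable {t : ℝ}

theorem retract_mem_hypersurface (hc : 0 < Real.cos t) (hs : 0 < Real.sin t) {z : Ambient p q}
    (hz : z ∈ punctured p q) : retract (Real.cos t) (Real.sin t) z ∈ hypersurface p q t := by
  have h₁ : ‖z.fst‖ ≠ 0 := norm_ne_zero_iff.2 hz.1
  have h₂ : ‖z.snd‖ ≠ 0 := norm_ne_zero_iff.2 hz.2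
  constructor
  · rw [retract_fst, norm_smul, Real.norm_of_nonneg (by positivity), div_mul_cancel₀ _ h₁]
  · rw [retract_snd, norm_smul, Real.norm_of_nonneg (by positivity), div_mul_cancel₀ _ h₂]

theorem retract_eq_self (hc : Real.cos t ≠ 0) (hs : Real.sin t ≠ 0) {z : Ambient p q}
    (hz : z ∈ hypersurface p q t) : retract (Real.cos t) (Real.sin t) z = z := by
  refine ambient_ext ?_ ?_
  · rw [retract_fst, hz.1, div_self hc, one_smul]
  · rw [retract_snd, hz.2, div_self hs, one_smul]

theorem hypersurface_subset_punctured (hc : Real.cos t ≠ 0) (hs : Real.sin t ≠ 0) :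
    hypersurface p q t ⊆ punctured p q := fun _ hz =>
  ⟨norm_ne_zero_iff.1 (hz.1 ▸ hc), norm_ne_zero_iff.1 (hz.2 ▸ hs)⟩

/-- The extension of a function on `C_t` that is constant on rays of both factors. -/
def radialExt (t : ℝ) (u : Ambient p q → ℝ) (z : Ambient p q) : ℝ :=
  u (retract (Real.cos t) (Real.sin t) z)

theorem radialExt_comp_scale (t : ℝ) (u : Ambient p q → ℝ) {α β : ℝ} (hα : 0 < α) (hβ : 0 < β) :
    radialExt t u ∘ scaleEquiv hα.ne' hβ.ne' = radialExt t u := by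
  funext z
  rw [Function.comp_apply, scaleEquiv_apply, radialExt, retract_scale hα hβ, radialExt]

theorem eqOn_radialExt (hc : Real.cos t ≠ 0) (hs : Real.sin t ≠ 0) (u : Ambient p q → ℝ) :
    EqOn u (radialExt t u) (hypersurface p q t) := fun z hz => by
  rw [radialExt, retract_eq_self hc hs hz]

theorem contDiffOn_radialExt (hc : 0 < Real.cos t) (hs : 0 < Real.sin t) {u : Ambient p q → ℝ}
    {n : WithTop ℕ∞} (hu : ContDiffOn ℝ n u (hypersurface p q t)) :
    ContDiffOn ℝ n (radialExt t u) (punctured p q) :=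
  hu.comp (contDiffOn_retract _ _) fun _ hz => retract_mem_hypersurface hc hs hz

theorem lieDeriv_lieDeriv_radialExt (hc : 0 < Real.cos t) (hs : 0 < Real.sin t)
    (u : Ambient p q → ℝ) (k : RotIndex p q) {z : Ambient p q} (hz : z ∈ punctured p q) :
    lieDeriv (generator k) (lieDeriv (generator k) (radialExt t u)) z =
      lieDeriv (generator k) (lieDeriv (generator k) (radialExt t u))
        (retract (Real.cos t) (Real.sin t) z) := by
  have hα : 0 < Real.cos t / ‖z.fst‖ := div_pos hc (norm_pos_iff.2 hz.1)
  have hβ : 0 < Real.sin t / ‖z.snd‖ := div_pos hs (norm_pos_iff.2 hz.2)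
  have hcomm : ∀ w : Ambient p q, scaleEquiv hα.ne' hβ.ne' (generator k w) =
      generator k (scaleEquiv hα.ne' hβ.ne' w) := scale_generator _ _ k
  have h₁ : lieDeriv (generator k) (radialExt t u) ∘ scaleEquiv hα.ne' hβ.ne' =
      lieDeriv (generator k) (radialExt t u) := funext fun w => by
    rw [Function.comp_apply, ← lieDeriv_comp_equiv _ _ _ hcomm, radialExt_comp_scale t u hα hβ]
  rw [retract_eq_scale, ← scaleEquiv_apply hα.ne' hβ.ne', ← lieDeriv_comp_equiv _ _ _ hcomm, h₁]

theorem sum_lieDeriv_radialExt_eq (hp : 1 ≤ p) (hq : 1 ≤ q) {u : Ambient p q → ℝ}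
    (hu : IsJacobiField (hypersurface p q (tStar p q)) (normal p q (tStar p q)) u)
    {z : Ambient p q} (hz : z ∈ punctured p q) :
    ∑ k, weight (Real.cos (tStar p q)) (Real.sin (tStar p q)) k *
      lieDeriv (generator k) (lieDeriv (generator k) (radialExt (tStar p q) u)) z =
        -(2 * (p + q) * radialExt (tStar p q) u z) := by
  have hc := cos_tStar_pos p q
  have hs := sin_tStar_pos hp hq
  have hp' : (0 : ℝ) < p := by exact_mod_cast hp
  have hq' : (0 : ℝ) < q := by exact_mod_cast hq
  simp only [lieDeriv_lieDeriv_radialExt hc hs u _ hz]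
  have hw := retract_mem_hypersurface hc hs hz
  have h := hu.jacobi_eq _ hw
  rw [jacobiOperator, laplaceOn_hypersurface hc.ne' hs.ne' isOpen_punctured
    (hypersurface_subset_punctured hc.ne' hs.ne') (contDiffOn_radialExt hc hs hu.contDiffOn)
    (eqOn_radialExt hc.ne' hs.ne' u) hw, sqNormSecondForm_hypersurface hc.ne' hs.ne' hw,
    finrank_ambient, div_pow, div_pow, cos_tStar_sq hp, sin_tStar_sq hp] at h
  have h₂ : (p : ℝ) * (q / (p + q) / (p / (p + q))) + q * (p / (p + q) / (q / (p + q))) +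
      (((p + q + 2 : ℕ) : ℝ) - 2) = 2 * (p + q) := by
    push_cast
    field_simp
    ring
  rw [h₂] at h
  rw [radialExt]
  linarith

end RadialExtension

section TestFunctions

theorem lieDeriv_clm {E : Type*} [NormedAddCommGroup E] [NormedSpace ℝ E] (A : E →L[ℝ] E)
    (l : E →L[ℝ] ℝ) (z : E) : lieDeriv A l z = l (A z) := by
  simp [lieDeriv]

theorem lieDeriv_mul_eq_zero {E : Type*} [NormedAddCommGroup E] [NormedSpace ℝ E] {A : E →L[ℝ] E}
    {f g : E → ℝ} (hf : Differentiable ℝ f) (hg : Differentiable ℝ g) (hAf : lieDeriv A f = 0)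
    (hAg : lieDeriv A g = 0) : lieDeriv A (fun z => f z * g z) = 0 := by
  funext z
  rw [lieDeriv_mul A (hf z) (hg z), hAf, hAg]
  simp

theorem lieDeriv_pow_eq_zero {E : Type*} [NormedAddCommGroup E] [NormedSpace ℝ E] {A : E →L[ℝ] E}
    {f : E → ℝ} (hf : Differentiable ℝ f) (hAf : lieDeriv A f = 0) (d : ℕ) :
    lieDeriv A (fun z => f z ^ d) = 0 := by
  funext z
  rw [lieDeriv_pow A (hf z), hAf]
  simp

theorem lieDeriv_lieDeriv_pow_mul {E : Type*} [NormedAddCommGroup E] [NormedSpace ℝ E]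
    (A : E →L[ℝ] E) (l : E →L[ℝ] ℝ) {ρ : E → ℝ} (hρ : Differentiable ℝ ρ)
    (hAρ : lieDeriv A ρ = 0) (d : ℕ) (z : E) :
    lieDeriv A (lieDeriv A fun w => l w ^ d * ρ w) z =
      (d * ((d - 1 : ℕ) : ℝ) * l z ^ (d - 2) * (l (A z) * l (A z))
        + d * l z ^ (d - 1) * l (A (A z))) * ρ z := by
  have hd : ∀ m w, DifferentiableAt ℝ (fun w => l w ^ m) w := fun m w =>
    l.differentiableAt.pow m
  have h₁ : (lieDeriv A fun w => l w ^ d * ρ w) =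
      fun w => ((d : ℝ) * (l w ^ (d - 1) * (l ∘L A) w)) * ρ w := funext fun w => by
    rw [lieDeriv_mul A (hd d w) (hρ w), hAρ, lieDeriv_pow A l.differentiableAt, lieDeriv_clm]
    simp
    ring
  have hm : DifferentiableAt ℝ (fun w => l w ^ (d - 1) * (l ∘L A) w) z :=
    (hd _ z).mul (l ∘L A).differentiableAt
  have hm' : DifferentiableAt ℝ (fun w => (d : ℝ) * (l w ^ (d - 1) * (l ∘L A) w)) z :=
    (differentiableAt_const _).mul hm
  rw [h₁, lieDeriv_mul A hm' (hρ z), hAρ, lieDeriv_mul A (differentiableAt_const _) hm,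
    lieDeriv_mul A (hd _ z) (l ∘L A).differentiableAt, lieDeriv_pow A l.differentiableAt,
    lieDeriv_clm, lieDeriv_clm]
  have h₀ : lieDeriv A (fun _ : E => (d : ℝ)) z = 0 := by simp [lieDeriv]
  rw [h₀, Nat.sub_sub]
  simp
  ring

theorem lieDeriv_norm_sq {E F : Type*} [NormedAddCommGroup E] [NormedSpace ℝ E]
    [NormedAddCommGroup F] [InnerProductSpace ℝ F] (A : E →L[ℝ] E) (P : E →L[ℝ] F) (z : E) :
    lieDeriv A (fun w => ‖P w‖ ^ 2) z = 2 * ⟪P z, P (A z)⟫_ℝ := by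
  rw [lieDeriv, (P.hasFDerivAt (x := z)).norm_sq.fderiv]
  simp

variable {p q : ℕ}

/-- The linear form `(x, y) ↦ ⟪a, x⟫`. -/
def formFst (a : EuclideanSpace ℝ (Fin (p + 1))) : Ambient p q →L[ℝ] ℝ := innerSL ℝ a ∘L projFst

/-- The linear form `(x, y) ↦ ⟪b, y⟫`. -/
def formSnd (b : EuclideanSpace ℝ (Fin (q + 1))) : Ambient p q →L[ℝ] ℝ := innerSL ℝ b ∘L projSnd

theorem formFst_apply (a : EuclideanSpace ℝ (Fin (p + 1))) (z : Ambient p q) :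
    formFst a z = ⟪a, z.fst⟫_ℝ := rfl

theorem formSnd_apply (b : EuclideanSpace ℝ (Fin (q + 1))) (z : Ambient p q) :
    formSnd b z = ⟪b, z.snd⟫_ℝ := rfl

/-- The radial monomial `‖x‖^{2j} ‖y‖^{2m}`. -/
def radialFun (j m : ℕ) (z : Ambient p q) : ℝ :=
  (‖projFst z‖ ^ 2) ^ j * (‖projSnd z‖ ^ 2) ^ m

theorem contDiff_radialFun (j m : ℕ) {n : WithTop ℕ∞} :
    ContDiff ℝ n (radialFun j m : Ambient p q → ℝ) :=
  ((projFst.contDiff.norm_sq ℝ).pow j).mul ((projSnd.contDiff.norm_sq ℝ).pow m)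

theorem radialFun_add_fst (j m i : ℕ) (z : Ambient p q) :
    radialFun (j + i) m z = (‖z.fst‖ ^ 2) ^ i * radialFun j m z := by
  simp only [radialFun, projFst_apply, pow_add]; ring

theorem radialFun_add_snd (j m i : ℕ) (z : Ambient p q) :
    radialFun j (m + i) z = (‖z.snd‖ ^ 2) ^ i * radialFun j m z := by
  simp only [radialFun, projSnd_apply, pow_add]; ring

theorem lieDeriv_radialFun {A : Ambient p q →L[ℝ] Ambient p q} (hA : IsBiskew A) (j m : ℕ) :
    lieDeriv A (radialFun j m) = 0 := by
  have h₁ : Differentiable ℝ fun z : Ambient p q => ‖projFst z‖ ^ 2 :=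
    projFst.differentiable.norm_sq ℝ
  have h₂ : Differentiable ℝ fun z : Ambient p q => ‖projSnd z‖ ^ 2 :=
    projSnd.differentiable.norm_sq ℝ
  refine lieDeriv_mul_eq_zero (h₁.pow j) (h₂.pow m) (lieDeriv_pow_eq_zero h₁ (funext fun z => ?_) j)
    (lieDeriv_pow_eq_zero h₂ (funext fun z => ?_) m)
  · rw [lieDeriv_norm_sq, projFst_apply, projFst_apply, hA.fst, mul_zero]; rfl
  · rw [lieDeriv_norm_sq, projSnd_apply, projSnd_apply, hA.snd, mul_zero]; rfl

/-- The test function `⟪a, x⟫^d ⟪b, y⟫^e ‖x‖^{2j} ‖y‖^{2m}`. -/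
def testFun (a : EuclideanSpace ℝ (Fin (p + 1))) (b : EuclideanSpace ℝ (Fin (q + 1)))
    (d e j m : ℕ) (z : Ambient p q) : ℝ :=
  formFst a z ^ d * (formSnd b z ^ e * radialFun j m z)

theorem contDiff_testFun (a : EuclideanSpace ℝ (Fin (p + 1))) (b : EuclideanSpace ℝ (Fin (q + 1)))
    (d e j m : ℕ) {n : WithTop ℕ∞} : ContDiff ℝ n (testFun a b d e j m) :=
  ((formFst a).contDiff.pow d).mul (((formSnd b).contDiff.pow e).mul (contDiff_radialFun j m))

theorem pow_sub_two_mul (x : ℝ) (d : ℕ) :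
    (d : ℝ) * ((d - 1 : ℕ) : ℝ) * x ^ (d - 2) * (x * x) = d * ((d - 1 : ℕ) : ℝ) * x ^ d := by
  rcases d with _ | _ | d
  · simp
  · simp
  · rw [show d + 1 + 1 - 2 = d from rfl]; ring

theorem pow_sub_one_mul_self (x : ℝ) (d : ℕ) : (d : ℝ) * x ^ (d - 1) * x = d * x ^ d := by
  rcases d with _ | d
  · simp
  · simp only [Nat.add_sub_cancel]; ring

theorem sum_lieDeriv_inl_testFun (a : EuclideanSpace ℝ (Fin (p + 1)))
    (b : EuclideanSpace ℝ (Fin (q + 1))) (d e j m : ℕ) (z : Ambient p q) :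
    ∑ k, lieDeriv (generator (.inl k)) (lieDeriv (generator (.inl k)) (testFun a b d e j m)) z =
      2 * (d * ((d - 1 : ℕ) : ℝ) * ‖a‖ ^ 2 * testFun a b (d - 2) e (j + 1) m z
        - d * (((d - 1 : ℕ) : ℝ) + p) * testFun a b d e j m z) := by
  have hρd : Differentiable ℝ fun w : Ambient p q => formSnd b w ^ e * radialFun j m w :=
    ((formSnd b).differentiable.pow e).mul ((contDiff_radialFun j m (n := 1)).differentiable
      one_ne_zero)
  have hρ : ∀ k, lieDeriv (generator (.inl k))
      (fun w : Ambient p q => formSnd b w ^ e * radialFun j m w) = 0 := fun k =>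
    lieDeriv_mul_eq_zero ((formSnd b).differentiable.pow e)
      ((contDiff_radialFun j m (n := 1)).differentiable one_ne_zero)
      (lieDeriv_pow_eq_zero (formSnd b).differentiable (funext fun w => by
        rw [lieDeriv_clm, formSnd_apply, generator_inl, inclFst_snd, inner_zero_right]; rfl) e)
      (lieDeriv_radialFun (isBiskew_generator _) j m)
  have h₁ : ∀ k, formFst a (generator (.inl k) z) = ⟪skewPair (EuclideanSpace.basisFun _ ℝ k.1)
      (EuclideanSpace.basisFun _ ℝ k.2) z.fst, a⟫_ℝ := fun k => by
    rw [formFst_apply, real_inner_comm, generator_inl, inclFst_fst]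
  have h₂ : ∀ k, formFst a (generator (.inl k) (generator (.inl k) z)) =
      ⟪skewPair (EuclideanSpace.basisFun _ ℝ k.1) (EuclideanSpace.basisFun _ ℝ k.2)
        (skewPair (EuclideanSpace.basisFun _ ℝ k.1) (EuclideanSpace.basisFun _ ℝ k.2) z.fst),
          a⟫_ℝ := fun k => by
    rw [formFst_apply, real_inner_comm, generator_inl, inclFst_fst, generator_inl, inclFst_fst]
  have h₃ : ∀ k, lieDeriv (generator (.inl k))
      (lieDeriv (generator (.inl k)) (testFun a b d e j m)) z = _ := fun k =>
    lieDeriv_lieDeriv_pow_mul (generator (.inl k)) (formFst a) hρd (hρ k) d z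
  simp only [h₃, h₁, h₂, ← Finset.sum_mul, Finset.sum_add_distrib, ← Finset.mul_sum,
    sum_inner_skewPair_mul, sum_inner_skewPair_sq, Fintype.card_fin]
  rw [testFun, testFun, radialFun_add_fst, real_inner_self_eq_norm_sq, real_inner_self_eq_norm_sq,
    formFst_apply, real_inner_comm z.fst a]
  have h₄ := pow_sub_two_mul ⟪z.fst, a⟫_ℝ d
  have h₅ := pow_sub_one_mul_self ⟪z.fst, a⟫_ℝ d
  push_cast
  linear_combination (-2 * (formSnd b z ^ e * radialFun j m z)) * h₄
    - (2 * p * (formSnd b z ^ e * radialFun j m z)) * h₅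

theorem sum_lieDeriv_inr_testFun (a : EuclideanSpace ℝ (Fin (p + 1)))
    (b : EuclideanSpace ℝ (Fin (q + 1))) (d e j m : ℕ) (z : Ambient p q) :
    ∑ k, lieDeriv (generator (.inr k)) (lieDeriv (generator (.inr k)) (testFun a b d e j m)) z =
      2 * (e * ((e - 1 : ℕ) : ℝ) * ‖b‖ ^ 2 * testFun a b d (e - 2) j (m + 1) z
        - e * (((e - 1 : ℕ) : ℝ) + q) * testFun a b d e j m z) := by
  have hρd : Differentiable ℝ fun w : Ambient p q => formFst a w ^ d * radialFun j m w :=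
    ((formFst a).differentiable.pow d).mul ((contDiff_radialFun j m (n := 1)).differentiable
      one_ne_zero)
  have hρ : ∀ k, lieDeriv (generator (.inr k))
      (fun w : Ambient p q => formFst a w ^ d * radialFun j m w) = 0 := fun k =>
    lieDeriv_mul_eq_zero ((formFst a).differentiable.pow d)
      ((contDiff_radialFun j m (n := 1)).differentiable one_ne_zero)
      (lieDeriv_pow_eq_zero (formFst a).differentiable (funext fun w => by
        rw [lieDeriv_clm, formFst_apply, generator_inr, inclSnd_fst, inner_zero_right]; rfl) d)
      (lieDeriv_radialFun (isBiskew_generator _) j m)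
  have h₁ : ∀ k, formSnd b (generator (.inr k) z) = ⟪skewPair (EuclideanSpace.basisFun _ ℝ k.1)
      (EuclideanSpace.basisFun _ ℝ k.2) z.snd, b⟫_ℝ := fun k => by
    rw [formSnd_apply, real_inner_comm, generator_inr, inclSnd_snd]
  have h₂ : ∀ k, formSnd b (generator (.inr k) (generator (.inr k) z)) =
      ⟪skewPair (EuclideanSpace.basisFun _ ℝ k.1) (EuclideanSpace.basisFun _ ℝ k.2)
        (skewPair (EuclideanSpace.basisFun _ ℝ k.1) (EuclideanSpace.basisFun _ ℝ k.2) z.snd),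
          b⟫_ℝ := fun k => by
    rw [formSnd_apply, real_inner_comm, generator_inr, inclSnd_snd, generator_inr, inclSnd_snd]
  have h₀ : testFun a b d e j m =
      fun w => formSnd b w ^ e * (formFst a w ^ d * radialFun j m w) := funext fun w => by
    rw [testFun]; ring
  have h₃ : ∀ k, lieDeriv (generator (.inr k))
      (lieDeriv (generator (.inr k)) (testFun a b d e j m)) z = _ := fun k =>
    (congrArg (fun f => lieDeriv (generator (.inr k)) (lieDeriv (generator (.inr k)) f) z) h₀).trans
      <| lieDeriv_lieDeriv_pow_mul (generator (.inr k)) (formSnd b) hρd (hρ k) e z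
  simp only [h₃, h₁, h₂, ← Finset.sum_mul, Finset.sum_add_distrib, ← Finset.mul_sum,
    sum_inner_skewPair_mul, sum_inner_skewPair_sq, Fintype.card_fin]
  rw [testFun, testFun, radialFun_add_snd, real_inner_self_eq_norm_sq, real_inner_self_eq_norm_sq,
    formSnd_apply, real_inner_comm z.snd b]
  have h₄ := pow_sub_two_mul ⟪z.snd, b⟫_ℝ e
  have h₅ := pow_sub_one_mul_self ⟪z.snd, b⟫_ℝ e
  push_cast
  linear_combination (-2 * (formFst a z ^ d * radialFun j m z)) * h₄
    - (2 * q * (formFst a z ^ d * radialFun j m z)) * h₅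

theorem sum_weight_lieDeriv_testFun (r s : ℝ) (a : EuclideanSpace ℝ (Fin (p + 1)))
    (b : EuclideanSpace ℝ (Fin (q + 1))) (d e j m : ℕ) (z : Ambient p q) :
    ∑ k, weight r s k * lieDeriv (generator k) (lieDeriv (generator k) (testFun a b d e j m)) z =
      (r ^ 2)⁻¹ * (d * ((d - 1 : ℕ) : ℝ) * ‖a‖ ^ 2 * testFun a b (d - 2) e (j + 1) m z
        - d * (((d - 1 : ℕ) : ℝ) + p) * testFun a b d e j m z) +
      (s ^ 2)⁻¹ * (e * ((e - 1 : ℕ) : ℝ) * ‖b‖ ^ 2 * testFun a b d (e - 2) j (m + 1) z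
        - e * (((e - 1 : ℕ) : ℝ) + q) * testFun a b d e j m z) := by
  rw [sum_weight_mul, sum_lieDeriv_inl_testFun, sum_lieDeriv_inr_testFun, mul_inv, mul_inv]
  ring

end TestFunctions

section Density

variable {E : Type*} [NormedAddCommGroup E] [InnerProductSpace ℝ E]

theorem ContinuousMap.exp_apply {X : Type*} [TopologicalSpace X] [CompactSpace X] (f : C(X, ℝ))
    (x : X) : NormedSpace.exp f x = Real.exp (f x) := by
  have h₁ := (NormedSpace.exp_series_hasSum_exp' (𝕂 := ℝ) f).mapL (ContinuousMap.evalCLM ℝ x)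
  have h₂ := NormedSpace.exp_series_hasSum_exp' (𝕂 := ℝ) (f x)
  rw [Real.exp_eq_exp_ℝ]
  refine HasSum.unique h₁ ?_
  simpa using h₂

/-- A continuous linear functional on `C(K, ℝ)` that kills all powers of the linear forms
`z ↦ ⟪w, z⟫` vanishes. -/
theorem eq_zero_of_forall_inner_pow {K : Set E} [CompactSpace K] (I : C(K, ℝ) →L[ℝ] ℝ)
    (l : E → C(K, ℝ)) (hl : ∀ w z, l w z = ⟪w, (z : E)⟫_ℝ)
    (h : ∀ w (m : ℕ), I (l w ^ m) = 0) : I = 0 := by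
  have hexp : ∀ w, I (NormedSpace.exp (l w)) = 0 := fun w => by
    have h₁ := (NormedSpace.exp_series_hasSum_exp' (𝕂 := ℝ) (l w)).mapL I
    simp only [map_smul, h, smul_zero] at h₁
    exact h₁.unique hasSum_zero
  have hladd : ∀ v w, l (v + w) = l v + l w := fun v w => ContinuousMap.ext fun z => by
    simp [hl, inner_add_left]
  let M : Submonoid C(K, ℝ) :=
    { carrier := range fun w => NormedSpace.exp (l w)
      one_mem' := ⟨0, by
        ext z
        simp [ContinuousMap.exp_apply, hl]⟩
      mul_mem' := by
        rintro _ _ ⟨v, rfl⟩ ⟨w, rfl⟩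
        refine ⟨v + w, ?_⟩
        ext z
        simp [ContinuousMap.exp_apply, hladd, Real.exp_add] }
  let A : Subalgebra ℝ C(K, ℝ) := Algebra.adjoin ℝ M
  have hAI : (A : Set C(K, ℝ)) ⊆ {g | I g = 0} := by
    have h₁ : Subalgebra.toSubmodule A ≤ LinearMap.ker I.toLinearMap := by
      rw [Algebra.adjoin_eq_span, Submonoid.closure_eq, Submodule.span_le]
      rintro _ ⟨w, rfl⟩
      exact hexp w
    exact h₁
  have hsep : A.SeparatesPoints := by
    intro x y hxy
    refine ⟨_, ⟨NormedSpace.exp (l ((x : E) - y)), Algebra.subset_adjoin ⟨_, rfl⟩, rfl⟩, ?_⟩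
    simp only [ContinuousMap.exp_apply, hl]
    intro he
    have h₁ := Real.exp_injective he
    rw [← sub_eq_zero, ← inner_sub_right, inner_self_eq_zero, sub_eq_zero] at h₁
    exact hxy (Subtype.ext h₁)
  have htop := ContinuousMap.subalgebra_topologicalClosure_eq_top_of_separatesPoints A hsep
  ext g
  have hg : g ∈ A.topologicalClosure := htop ▸ Algebra.mem_top
  exact closure_minimal hAI (isClosed_singleton.preimage I.continuous) hg

theorem setIntegral_mul_self_eq_zero_of_forall_inner_pow [MeasurableSpace E] [BorelSpace E]
    {μ : Measure E}
    [IsFiniteMeasureOnCompacts μ] {K : Set E} (hK : IsCompact K) {f : E → ℝ}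
    (hf : ContinuousOn f K) (h : ∀ (w : E) (m : ℕ), ∫ z in K, f z * ⟪w, z⟫_ℝ ^ m ∂μ = 0) :
    ∫ z in K, f z * f z ∂μ = 0 := by
  have : CompactSpace K := isCompact_iff_compactSpace.1 hK
  set ν : Measure K := μ.comap Subtype.val with hν
  have : IsFiniteMeasure ν := ⟨by
    rw [hν, comap_subtype_coe_apply hK.measurableSet, image_univ, Subtype.range_coe]
    exact hK.measure_lt_top⟩
  let F : C(K, ℝ) := ⟨K.domRestrict f, hf.domRestrict⟩
  have hint : ∀ g : C(K, ℝ), Integrable (fun z => F z * g z) ν := fun g =>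
    (F * g).continuous.integrable_of_hasCompactSupport (HasCompactSupport.of_compactSpace _)
  let I : C(K, ℝ) →L[ℝ] ℝ := LinearMap.mkContinuous
    { toFun := fun g => ∫ z, F z * g z ∂ν
      map_add' := fun g g' => by
        rw [← integral_add (hint g) (hint g')]
        simp [mul_add]
      map_smul' := fun c g => by
        rw [RingHom.id_apply, smul_eq_mul, ← integral_const_mul]
        simp [mul_left_comm] }
    (∫ z, ‖F z‖ ∂ν) fun g => by
      rw [← integral_mul_const]
      refine norm_integral_le_of_norm_le
        ((by simpa using (hint 1).norm : Integrable (fun z => ‖F z‖) ν).mul_const _)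
        (Filter.Eventually.of_forall fun z => ?_)
      rw [norm_mul]
      exact mul_le_mul_of_nonneg_left (g.norm_coe_le_norm z) (norm_nonneg _)
  let l : E → C(K, ℝ) := fun w => ⟨fun z => ⟪w, (z : E)⟫_ℝ, by fun_prop⟩
  have hI : I = 0 := eq_zero_of_forall_inner_pow I l (fun _ _ => rfl) fun w m => by
    rw [← h w m, ← integral_subtype_comap hK.measurableSet]
    rfl
  rw [← integral_subtype_comap hK.measurableSet]
  exact congrArg (fun J : C(K, ℝ) →L[ℝ] ℝ => J F) hI

end Density

section Vanishing

variable {p q : ℕ}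

theorem setIntegral_sum_lieDeriv_mul (c : RotIndex p q → ℝ) {f g : Ambient p q → ℝ}
    (hf : ContDiffOn ℝ 2 f (punctured p q)) (hg : ContDiffOn ℝ 2 g (punctured p q)) :
    ∫ z in shell p q, (∑ k, c k * lieDeriv (generator k) (lieDeriv (generator k) f) z) * g z =
      ∫ z in shell p q,
        f z * ∑ k, c k * lieDeriv (generator k) (lieDeriv (generator k) g) z := by
  have hc : ∀ {h : Ambient p q → ℝ} (k), ContDiffOn ℝ 2 h (punctured p q) →
      ContinuousOn (lieDeriv (generator k) (lieDeriv (generator k) h)) (punctured p q) :=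
    fun k hh => (contDiffOn_lieDeriv (m := 0) _ isOpen_punctured (contDiffOn_lieDeriv (m := 1) _
      isOpen_punctured hh (by norm_num)) (by norm_num)).continuousOn
  have h₁ : ∀ k, IntegrableOn
      (fun z => c k * (lieDeriv (generator k) (lieDeriv (generator k) f) z * g z)) (shell p q) :=
    fun k => (integrableOn_shell ((hc k hf).mul hg.continuousOn)).const_mul (c k)
  have h₂ : ∀ k, IntegrableOn
      (fun z => c k * (f z * lieDeriv (generator k) (lieDeriv (generator k) g) z)) (shell p q) :=
    fun k => (integrableOn_shell (hf.continuousOn.mul (hc k hg))).const_mul (c k)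
  simp only [Finset.sum_mul, Finset.mul_sum, mul_assoc, mul_left_comm (f _)]
  rw [integral_finsetSum _ fun k _ => h₁ k, integral_finsetSum _ fun k _ => h₂ k]
  refine Finset.sum_congr rfl fun k _ => ?_
  rw [integral_const_mul, integral_const_mul,
    setIntegral_lieDeriv_lieDeriv_mul (isBiskew_generator k) hf hg]

theorem integrableOn_mul_testFun {U : Ambient p q → ℝ} (hU : ContinuousOn U (punctured p q))
    (a : EuclideanSpace ℝ (Fin (p + 1))) (b : EuclideanSpace ℝ (Fin (q + 1))) (d e j m : ℕ) :
    IntegrableOn (fun z => U z * testFun a b d e j m z) (shell p q) :=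
  integrableOn_shell (hU.mul (contDiff_testFun a b d e j m (n := 0)).continuous.continuousOn)

/-- The pair of degrees `(1, 1)` is the only one with eigenvalue `2`. -/
theorem degree_eigenvalue_ne_two (hp : 1 ≤ p) (hq : 1 ≤ q) {d e : ℕ} (hde : ¬ (d = 1 ∧ e = 1)) :
    (d : ℝ) * (((d - 1 : ℕ) : ℝ) + p) / p + e * (((e - 1 : ℕ) : ℝ) + q) / q ≠ 2 := by
  have key : ∀ {n : ℕ} (_ : 1 ≤ n) (k : ℕ), 2 ≤ k →
      2 < (k : ℝ) * (((k - 1 : ℕ) : ℝ) + n) / n := by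
    intro n hn k hk
    have hn' : (0 : ℝ) < n := by exact_mod_cast hn
    have hk' : (2 : ℝ) ≤ k := by exact_mod_cast hk
    have hk1 : (1 : ℝ) ≤ ((k - 1 : ℕ) : ℝ) := by exact_mod_cast (by omega : 1 ≤ k - 1)
    rw [lt_div_iff₀ hn']
    nlinarith
  have hp' : (0 : ℝ) < p := by exact_mod_cast hp
  have hq' : (0 : ℝ) < q := by exact_mod_cast hq
  have h₁ : 0 ≤ (d : ℝ) * (((d - 1 : ℕ) : ℝ) + p) / p := by positivity
  have h₂ : 0 ≤ (e : ℝ) * (((e - 1 : ℕ) : ℝ) + q) / q := by positivity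
  rcases le_or_gt 2 d with hd | hd
  · linarith [key hp d hd]
  rcases le_or_gt 2 e with he | he
  · linarith [key hq e he]
  interval_cases d <;> interval_cases e <;> simp_all [hp'.ne', hq'.ne']

theorem setIntegral_mul_testFun_eq_zero (hp : 1 ≤ p) (hq : 1 ≤ q) {u : Ambient p q → ℝ}
    (hu : IsJacobiField (hypersurface p q (tStar p q)) (normal p q (tStar p q)) u)
    (a : EuclideanSpace ℝ (Fin (p + 1))) (b : EuclideanSpace ℝ (Fin (q + 1)))
    (h11 : ∀ j m, ∫ z in shell p q, radialExt (tStar p q) u z * testFun a b 1 1 j m z = 0)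
    (N d e : ℕ) (hN : d + e ≤ N) (j m : ℕ) :
    ∫ z in shell p q, radialExt (tStar p q) u z * testFun a b d e j m z = 0 := by
  induction N using Nat.strong_induction_on generalizing d e j m with
  | _ N ih =>
  by_cases hde : d = 1 ∧ e = 1
  · obtain ⟨rfl, rfl⟩ := hde
    exact h11 j m
  have hc := cos_tStar_pos p q
  have hs := sin_tStar_pos hp hq
  have hp' : (0 : ℝ) < p := by exact_mod_cast hp
  have hq' : (0 : ℝ) < q := by exact_mod_cast hq
  have hU := contDiffOn_radialExt hc hs hu.contDiffOn
  set U := radialExt (tStar p q) u with hUdef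
  have hsym := setIntegral_sum_lieDeriv_mul (weight (Real.cos (tStar p q)) (Real.sin (tStar p q)))
    hU (contDiff_testFun a b d e j m).contDiffOn
  have hint : ∀ d e j m, IntegrableOn (fun z => U z * testFun a b d e j m z) (shell p q) :=
    integrableOn_mul_testFun hU.continuousOn a b
  have hleft : ∫ z in shell p q, (∑ k, weight (Real.cos (tStar p q)) (Real.sin (tStar p q)) k *
      lieDeriv (generator k) (lieDeriv (generator k) U) z) * testFun a b d e j m z =
        -(2 * (p + q)) * ∫ z in shell p q, U z * testFun a b d e j m z := by
    rw [← integral_const_mul]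
    refine setIntegral_congr_fun isCompact_shell.measurableSet fun z hz => ?_
    simp only [hUdef, sum_lieDeriv_radialExt_eq hp hq hu (shell_subset_punctured hz)]
    ring
  have hd : (d * ((d - 1 : ℕ) : ℝ) * ‖a‖ ^ 2) *
      ∫ z in shell p q, U z * testFun a b (d - 2) e (j + 1) m z = 0 := by
    rcases d with _ | _ | d
    · simp
    · simp
    · rw [show d + 1 + 1 - 2 = d from rfl, ih (d + e) (by omega) d e le_rfl, mul_zero]
  have he : (e * ((e - 1 : ℕ) : ℝ) * ‖b‖ ^ 2) *
      ∫ z in shell p q, U z * testFun a b d (e - 2) j (m + 1) z = 0 := by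
    rcases e with _ | _ | e
    · simp
    · simp
    · rw [show e + 1 + 1 - 2 = e from rfl, ih (d + e) (by omega) d e le_rfl, mul_zero]
  set J := ∫ z in shell p q, U z * testFun a b d e j m z with hJ
  have hright : ∫ z in shell p q, U z *
      ∑ k, weight (Real.cos (tStar p q)) (Real.sin (tStar p q)) k *
        lieDeriv (generator k) (lieDeriv (generator k) (testFun a b d e j m)) z =
      -((p + q) * (d * (((d - 1 : ℕ) : ℝ) + p) / p + e * (((e - 1 : ℕ) : ℝ) + q) / q)) * J := by
    have h : ∀ z, U z * ∑ k, weight (Real.cos (tStar p q)) (Real.sin (tStar p q)) k *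
        lieDeriv (generator k) (lieDeriv (generator k) (testFun a b d e j m)) z =
        ((p + q) / p) * ((d * ((d - 1 : ℕ) : ℝ) * ‖a‖ ^ 2) *
          (U z * testFun a b (d - 2) e (j + 1) m z)) +
        ((p + q) / q) * ((e * ((e - 1 : ℕ) : ℝ) * ‖b‖ ^ 2) *
          (U z * testFun a b d (e - 2) j (m + 1) z)) +
        -((p + q) * (d * (((d - 1 : ℕ) : ℝ) + p) / p + e * (((e - 1 : ℕ) : ℝ) + q) / q)) *
          (U z * testFun a b d e j m z) := fun z => by
      rw [sum_weight_lieDeriv_testFun, cos_tStar_sq hp, sin_tStar_sq hp, inv_div, inv_div]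
      ring
    simp only [h]
    have h₁ := ((hint (d - 2) e (j + 1) m).const_mul (d * ((d - 1 : ℕ) : ℝ) * ‖a‖ ^ 2)).const_mul
      ((p + q) / p : ℝ)
    have h₂ := ((hint d (e - 2) j (m + 1)).const_mul (e * ((e - 1 : ℕ) : ℝ) * ‖b‖ ^ 2)).const_mul
      ((p + q) / q : ℝ)
    have h₁₂ := h₁.add h₂
    simp only [Pi.add_def] at h₁₂
    rw [integral_add h₁₂ ((hint _ _ _ _).const_mul _), integral_add h₁ h₂]
    simp only [integral_const_mul]
    rw [hd, he, ← hJ]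
    ring
  rw [hleft, hright] at hsym
  have hne := degree_eigenvalue_ne_two hp hq hde
  have hprod : (p + q : ℝ) * ((d * (((d - 1 : ℕ) : ℝ) + p) / p
      + e * (((e - 1 : ℕ) : ℝ) + q) / q) - 2) * J = 0 := by linear_combination hsym
  rcases mul_eq_zero.1 hprod with h | h
  · rcases mul_eq_zero.1 h with h | h
    · exact absurd h (by positivity)
    · exact absurd (sub_eq_zero.1 h) hne
  · exact h

/-- The action of an element of `O(p+1) × O(q+1)` as an isometry. -/
def actIsometry (σ : Orth p × Orth q) : Ambient p q ≃ₗᵢ[ℝ] Ambient p q :=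
  LinearIsometryEquiv.withLpProdCongr 2 σ.1 σ.2

theorem actIsometry_apply (σ : Orth p × Orth q) (z : Ambient p q) :
    actIsometry σ z = act σ z := rfl

theorem act_fst (σ : Orth p × Orth q) (z : Ambient p q) : (act σ z).fst = σ.1 z.fst := rfl

theorem act_snd (σ : Orth p × Orth q) (z : Ambient p q) : (act σ z).snd = σ.2 z.snd := rfl

theorem retract_act (r s : ℝ) (σ : Orth p × Orth q) (z : Ambient p q) :
    retract r s (act σ z) = act σ (retract r s z) := by
  refine ambient_ext ?_ ?_ <;> simp [act_fst, act_snd]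

theorem setIntegral_testFun_act (hp : 1 ≤ p) (hq : 1 ≤ q) {u : Ambient p q → ℝ}
    {G : Subgroup (Orth p × Orth q)}
    (hinv : IsInvariantOn G (hypersurface p q (tStar p q)) u) {σ : Orth p × Orth q} (hσ : σ ∈ G)
    (a : EuclideanSpace ℝ (Fin (p + 1))) (b : EuclideanSpace ℝ (Fin (q + 1))) (d e j m : ℕ) :
    ∫ z in shell p q, radialExt (tStar p q) u z * testFun (σ.1 a) (σ.2 b) d e j m z =
      ∫ z in shell p q, radialExt (tStar p q) u z * testFun a b d e j m z := by
  rw [← setIntegral_shell_comp (actIsometry σ) (fun z => by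
    rw [actIsometry_apply, act_fst, LinearIsometryEquiv.norm_map]) (fun z => by
    rw [actIsometry_apply, act_snd, LinearIsometryEquiv.norm_map])]
  refine setIntegral_congr_fun isCompact_shell.measurableSet fun z hz => ?_
  have hz' := retract_mem_hypersurface (cos_tStar_pos p q) (sin_tStar_pos hp hq)
    (shell_subset_punctured hz)
  have h₁ : radialExt (tStar p q) u (actIsometry σ z) = radialExt (tStar p q) u z := by
    rw [actIsometry_apply, radialExt, retract_act, hinv σ hσ _ hz', radialExt]
  have h₂ : testFun (σ.1 a) (σ.2 b) d e j m (actIsometry σ z) = testFun a b d e j m z := by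
    simp only [testFun, radialFun, formFst_apply, formSnd_apply, projFst_apply, projSnd_apply,
      actIsometry_apply, act_fst, act_snd, LinearIsometryEquiv.inner_map_map,
      LinearIsometryEquiv.norm_map]
  simp only [h₁, h₂]

theorem bilinearFun_setIntegral {U : Ambient p q → ℝ} (hU : ContinuousOn U (punctured p q))
    (j m : ℕ) (w : Ambient p q) :
    bilinearFun (fun k l => ∫ z in shell p q, U z * testFun (EuclideanSpace.basisFun _ ℝ k)
      (EuclideanSpace.basisFun _ ℝ l) 1 1 j m z) w =
      ∫ z in shell p q, U z * testFun w.fst w.snd 1 1 j m z := by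
  have hint : ∀ a b, IntegrableOn (fun z => U z * testFun a b 1 1 j m z) (shell p q) :=
    fun a b => integrableOn_mul_testFun hU a b 1 1 j m
  have h : ∀ z : Ambient p q, U z * testFun w.fst w.snd 1 1 j m z =
      ∑ k, ∑ l, (U z * testFun (EuclideanSpace.basisFun _ ℝ k)
        (EuclideanSpace.basisFun _ ℝ l) 1 1 j m z) * (w.fst k * w.snd l) := fun z => by
    simp only [testFun, formFst_apply, formSnd_apply, pow_one, EuclideanSpace.basisFun_apply,
      EuclideanSpace.inner_single_left, map_one, one_mul]
    rw [PiLp.inner_apply, PiLp.inner_apply, Finset.sum_mul, Finset.mul_sum]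
    refine Finset.sum_congr rfl fun k _ => ?_
    rw [Finset.sum_mul, Finset.mul_sum, Finset.mul_sum]
    refine Finset.sum_congr rfl fun l _ => ?_
    simp only [RCLike.inner_apply, conj_trivial]
    ring
  simp only [h]
  rw [integral_finsetSum _ fun k _ => integrable_finsetSum _ fun l _ => (hint _ _).mul_const _]
  refine Finset.sum_congr rfl fun k _ => ?_
  rw [integral_finsetSum _ fun l _ => (hint _ _).mul_const _]
  refine Finset.sum_congr rfl fun l _ => ?_
  rw [integral_mul_const, mul_assoc]

theorem setIntegral_testFun_one_one_eq_zero (hp : 1 ≤ p) (hq : 1 ≤ q) {u : Ambient p q → ℝ}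
    (hu : ContDiffOn ℝ 2 u (hypersurface p q (tStar p q))) {G : Subgroup (Orth p × Orth q)}
    (hG : ¬ ∃ a : Fin (p + 1) → Fin (q + 1) → ℝ, a ≠ 0 ∧ IsInvariantOn G univ (bilinearFun a))
    (hinv : IsInvariantOn G (hypersurface p q (tStar p q)) u)
    (a : EuclideanSpace ℝ (Fin (p + 1))) (b : EuclideanSpace ℝ (Fin (q + 1))) (j m : ℕ) :
    ∫ z in shell p q, radialExt (tStar p q) u z * testFun a b 1 1 j m z = 0 := by
  have hU := (contDiffOn_radialExt (cos_tStar_pos p q) (sin_tStar_pos hp hq) hu).continuousOn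
  set A : Fin (p + 1) → Fin (q + 1) → ℝ := fun k l => ∫ z in shell p q,
    radialExt (tStar p q) u z * testFun (EuclideanSpace.basisFun _ ℝ k)
      (EuclideanSpace.basisFun _ ℝ l) 1 1 j m z with hA
  have hbil : ∀ w, bilinearFun A w = _ := bilinearFun_setIntegral hU j m
  have hA0 : A = 0 := by
    by_contra hne
    refine hG ⟨A, hne, fun σ hσ w _ => ?_⟩
    rw [hbil, hbil, act_fst, act_snd, setIntegral_testFun_act hp hq hinv hσ]
  have h := hbil (WithLp.toLp 2 (a, b))
  rw [hA0] at h
  rw [WithLp.toLp_fst, WithLp.toLp_snd] at h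
  rw [← h]
  simp [bilinearFun]

theorem radialExt_eq_zero_of_setIntegral {t : ℝ} {u : Ambient p q → ℝ} (hc : 0 < Real.cos t)
    (hs : 0 < Real.sin t) (hu : ContinuousOn (radialExt t u) (punctured p q))
    (h : ∫ z in shell p q, radialExt t u z * radialExt t u z = 0) :
    ∀ z ∈ hypersurface p q t, u z = 0 := by
  intro z hz
  have hae := (setIntegral_eq_zero_iff_of_nonneg_ae
    (Filter.Eventually.of_forall fun z => mul_self_nonneg (radialExt t u z))
    (integrableOn_shell (hu.mul hu))).1 h
  set O : Set (Ambient p q) := {z | (1 < ‖z.fst‖ ∧ ‖z.fst‖ < 2) ∧ 1 < ‖z.snd‖ ∧ ‖z.snd‖ < 2} with hO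
  have hOopen : IsOpen O :=
    ((isOpen_lt continuous_const continuous_norm_fst).inter
      (isOpen_lt continuous_norm_fst continuous_const)).inter
      ((isOpen_lt continuous_const continuous_norm_snd).inter
      (isOpen_lt continuous_norm_snd continuous_const))
  have hOK : O ⊆ shell p q := fun w hw => ⟨⟨hw.1.1.le, hw.1.2.le⟩, hw.2.1.le, hw.2.2.le⟩
  have heq := Measure.eqOn_open_of_ae_eq (ae_restrict_of_ae_restrict_of_subset hOK hae) hOopen
    ((hu.mul hu).mono (hOK.trans shell_subset_punctured)) continuousOn_const
  have hα : 0 < 3 / 2 / Real.cos t := by positivity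
  have hβ : 0 < 3 / 2 / Real.sin t := by positivity
  have hw : scale (3 / 2 / Real.cos t) (3 / 2 / Real.sin t) z ∈ O := by
    have h₁ : ‖(scale (3 / 2 / Real.cos t) (3 / 2 / Real.sin t) z).fst‖ = 3 / 2 := by
      rw [scale_fst, norm_smul, Real.norm_of_nonneg hα.le, hz.1, div_mul_cancel₀ _ hc.ne']
    have h₂ : ‖(scale (3 / 2 / Real.cos t) (3 / 2 / Real.sin t) z).snd‖ = 3 / 2 := by
      rw [scale_snd, norm_smul, Real.norm_of_nonneg hβ.le, hz.2, div_mul_cancel₀ _ hs.ne']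
    rw [hO, mem_ofPred_eq, h₁, h₂]
    norm_num
  have h₀ := mul_self_eq_zero.1 (heq hw)
  rwa [radialExt, retract_scale hα hβ, retract_eq_self hc.ne' hs.ne' hz] at h₀

end Vanishing

end

end Clifford

theorem corollary3 (p q : ℕ) (hp : 1 ≤ p) (hq : 1 ≤ q)
    (G : Subgroup (Clifford.Orth p × Clifford.Orth q)) (hfin : Finite G)
    (hρ : (Clifford.axisReflection p, Clifford.axisReflection q) ∈ G)
    (hG : ¬ ∃ a : Fin (p + 1) → Fin (q + 1) → ℝ, a ≠ 0 ∧
      Clifford.IsInvariantOn G Set.univ (Clifford.bilinearFun a))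
    (u : Clifford.Ambient p q → ℝ)
    (hu : Clifford.IsJacobiField (Clifford.hypersurface p q (Clifford.tStar p q))
      (Clifford.normal p q (Clifford.tStar p q)) u)
    (hinv : Clifford.IsInvariantOn G (Clifford.hypersurface p q (Clifford.tStar p q)) u) :
    ∀ z ∈ Clifford.hypersurface p q (Clifford.tStar p q), u z = 0 := by
  have hc := Clifford.cos_tStar_pos p q
  have hs := Clifford.sin_tStar_pos hp hq
  have hU := (Clifford.contDiffOn_radialExt hc hs hu.contDiffOn).continuousOn
  refine Clifford.radialExt_eq_zero_of_setIntegral hc hs hU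
    (Clifford.setIntegral_mul_self_eq_zero_of_forall_inner_pow Clifford.isCompact_shell
      (hU.mono Clifford.shell_subset_punctured) fun w n => ?_)
  have h : ∀ z, Clifford.radialExt (Clifford.tStar p q) u z * ⟪w, z⟫_ℝ ^ n =
      ∑ k ∈ Finset.range (n + 1), (Clifford.radialExt (Clifford.tStar p q) u z *
        Clifford.testFun w.fst w.snd k (n - k) 0 0 z) * (n.choose k : ℝ) := fun z => by
    rw [Clifford.ambient_inner, add_pow, Finset.mul_sum]
    refine Finset.sum_congr rfl fun k _ => ?_
    simp only [Clifford.testFun, Clifford.radialFun, Clifford.formFst_apply,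
      Clifford.formSnd_apply, pow_zero, mul_one]
    ring
  simp only [h]
  rw [MeasureTheory.integral_finsetSum _ fun k _ =>
    (Clifford.integrableOn_mul_testFun hU _ _ _ _ _ _).mul_const _]
  refine Finset.sum_eq_zero fun k _ => ?_
  rw [MeasureTheory.integral_mul_const, Clifford.setIntegral_mul_testFun_eq_zero hp hq hu _ _
    (Clifford.setIntegral_testFun_one_one_eq_zero hp hq hu.contDiffOn hG hinv _ _) _ _ _ le_rfl,
    zero_mul]
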